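/- Let $\mathcal S$ be a quantum system with finite-dimensional complex Hilbert space $\mathfrak h_{\mathcal S}$ and self-adjoint Hamiltonian $h_{\mathcal S}$, and let $\mathcal B^1(\mathfrak h_{\mathcal S})$ be the space of trace class operators on $\mathfrak h_{\mathcal S}$ (that is, all linear operators, since $\dim\mathfrak h_{\mathcal S}<\infty$). A state of $\mathcal S$ is a positive operator of trace one. A linear map $\mathcal L:\mathcal B^1(\mathfrak h_{\mathcal S})\to\mathcal B^1(\mathfrak h_{\mathcal S})$ is a *reduced dynamics map* (RDM) if there are a Hilbert space $\mathfrak h_{\mathcal E}$, a self-adjoint Hamiltonian $h_{\mathcal E}$ on it, an interaction operator $v$ on $\mathfrak h_{\mathcal S}\otimes\mathfrak h_{\mathcal E}$ (symmetric, and such that $h=h_{\mathcal S}\otimes 1+1\otimes h_{\mathcal E}+v$ is essentially self-adjoint), a time $\tau>0$ and a density operator $\rho_{\mathcal E}$ on $\mathfrak h_{\mathcal E}$ which is invariant under the free dynamics $e^{-\mathrm i t h_{\mathcal E}}$, such that for every $\rho$ $$\mathcal L(\rho)=\mathrm{Tr}_{\mathfrak h_{\mathcal E}}\left[e^{-\mathrm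 i\tau h}\,(\rho\otimes\rho_{\mathcal E})\,e^{\mathrm i\tau h}\right].$$ A linear map $\mathcal L$ on $\mathcal B^1(\mathfrak h_{\mathcal S})$ satisfies **(E)** if its spectrum on the complex unit circle consists of the single eigenvalue $1$ and this eigenvalue is (algebraically) simple. Let $\mathcal M_{(E)}$ be the set of RDMs that satisfy (E). Let $(\Omega_0,\mathcal F,\mathrm p)$ be a probability space, let $\Omega=\Omega_0^{\mathbb N^*}$ carry the product measure $\mathbb P=\prod_{j\ge1}\mathrm p$, and let $\omega_0\mapsto\mathcal L(\omega_0)$ be a measurable map on $\Omega_0$ whose values are RDMs. For $\omega=(\omega_n)_{n\ge1}\in\Omega$ and an initial state $\rho$ put $$\rho(n,\omega)=\big(\mathcal L(\omega_n)\circ\cdots\circ\mathcal L(\omega_1)\big)(\rho).$$ **Theorem.** Suppose that $\mathrm p(\mathcal L(\omega_0)\in\mathcal M_{(E)})>0$. Then: 1. $\mathcal L$ is $\mathrm p$-integrable and its mean $\mathbb E(\mathcal L)=\int_{\Omega_0}\mathcal L(\omega_0)\,d\mathrm p(\omega_0)$ satisfies (E). 2. $\mathbb E(\mathcal L)$ has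 a unique invariant state $\rho_{\mathcal S,+}$, and there is a measurable set $\tilde\Omega\subset\Omega$ with $\mathbb P(\tilde\Omega)=1$ such that for every $\omega\in\tilde\Omega$ and every initial state $\rho$ $$\lim_{N\to\infty}\frac1N\sum_{n=1}^N\rho(n,\omega)=\rho_{\mathcal S,+}.$$ -/

import Mathlib

open Filter Topology MeasureTheory
open scoped TensorProduct

set_option maxSynthPendingDepth 3

universe u v

namespace RepeatedInteraction

/-! ### Unitary propagators and unbounded Hamiltonians -/

section Propagator

variable {E : Type*} [NormedAddCommGroup E] [InnerProductSpace ℂ E]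

/-- `U` is the one-parameter group `t ↦ exp (-i t T)`: a strongly continuous one-parameter unitary
group whose (full) generator is `T`, i.e. `T x = i (d/dt) U t x` at `t = 0`, the domain of `T` being
exactly the set of those `x` for which the derivative exists. By Stone's theorem, on a Hilbert space
such a group exists if and only if `T` is self-adjoint, and it is then unique. -/
structure IsPropagator (U : ℝ → E ≃ₗᵢ[ℂ] E) (T : E →ₗ.[ℂ] E) : Prop where
  map_zero : ∀ x, U 0 x = x
  map_add : ∀ s t x, U (s + t) x = U s (U t x)
  continuous : ∀ x, Continuous fun t => U t x
  generator : ∀ x y, (x, y) ∈ T.graph ↔ HasDerivAt (fun t => U t x) (-Complex.I • y) 0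

/-- Density operators (states) on a Hilbert space of arbitrary dimension: positive operators of
trace one, the trace being computed in every orthonormal basis. -/
structure IsDensityOperator (ρ : E →L[ℂ] E) : Prop where
  isPositive : ρ.IsPositive
  hasTrace_one : ∀ (w : Set E) (b : HilbertBasis w ℂ E), HasSum (fun i => inner ℂ (b i) (ρ (b i))) 1

end Propagator

section Tensor

variable (H : Type*) [NormedAddCommGroup H] [InnerProductSpace ℂ H]
variable {K : Type*} [NormedAddCommGroup K] [InnerProductSpace ℂ K]

/-- `1 ⊗ T` on `H ⊗ K`, with domain `H ⊗ dom T`, for a possibly unbounded operator `T` on `K`. -/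
noncomputable def idTensor (T : K →ₗ.[ℂ] K) : (H ⊗[ℂ] K) →ₗ.[ℂ] (H ⊗[ℂ] K) where
  domain := LinearMap.range (T.domain.subtype.lTensor H)
  toFun := (T.toFun.lTensor H) ∘ₗ
    (LinearEquiv.ofInjective (T.domain.subtype.lTensor H)
      (Module.Flat.lTensor_preserves_injective_linearMap (M := H) T.domain.subtype
        T.domain.injective_subtype)).symm.toLinearMap

variable {H}

/-- `S ⊗ 1` on `H ⊗ K`, with full domain, for an everywhere defined operator `S` on `H`. -/
noncomputable def tensorId (K : Type*) [NormedAddCommGroup K] [InnerProductSpace ℂ K]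
    (S : H →ₗ[ℂ] H) : (H ⊗[ℂ] K) →ₗ.[ℂ] (H ⊗[ℂ] K) :=
  (S.rTensor K).toPMap ⊤

/-- The operator `A` on `H` is the partial trace over `K` of the operator `T` on `H ⊗ K`:
`⟪x, A y⟫ = ∑ i, ⟪x ⊗ b i, T (y ⊗ b i)⟫` for every orthonormal basis `b` of `K`. -/
def HasPartialTrace (T : (H ⊗[ℂ] K) →L[ℂ] (H ⊗[ℂ] K)) (A : H →L[ℂ] H) : Prop :=
  ∀ (w : Set K) (b : HilbertBasis w ℂ K) (x y : H),
    HasSum (fun i => inner ℂ (x ⊗ₜ[ℂ] b i) (T (y ⊗ₜ[ℂ] b i))) (inner ℂ x (A y))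

end Tensor

/-! ### Reduced dynamics maps -/

variable {H : Type u} [NormedAddCommGroup H] [InnerProductSpace ℂ H]

/-- One interaction of the small system (Hilbert space `H`, Hamiltonian `hS`) with a subsystem of
the environment. The total Hamiltonian `hS ⊗ 1 + 1 ⊗ hE + V` is essentially self-adjoint (that is,
its closure generates a unitary group) and the reference state of the subsystem is invariant
under the free dynamics of the subsystem. -/
structure Interaction (hS : H →ₗ[ℂ] H) where
  /-- the Hilbert space of the subsystem -/
  K : Type v
  [instNormedAddCommGroup : NormedAddCommGroup K]
  [instInnerProductSpace : InnerProductSpace ℂ K]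
  [instCompleteSpace : CompleteSpace K]
  /-- the (possibly unbounded) Hamiltonian of the subsystem -/
  hE : K →ₗ.[ℂ] K
  hE_selfAdjoint : IsSelfAdjoint hE
  /-- the free dynamics `exp (-i t hE)` of the subsystem -/
  freeU : ℝ → K ≃ₗᵢ[ℂ] K
  freeU_isPropagator : IsPropagator freeU hE
  /-- the (possibly unbounded) interaction operator -/
  V : (H ⊗[ℂ] K) →ₗ.[ℂ] (H ⊗[ℂ] K)
  V_symmetric : V.IsFormalAdjoint V
  /-- the coupled dynamics `exp (-i t h)`, where `h = hS ⊗ 1 + 1 ⊗ hE + V` -/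
  U : ℝ → (H ⊗[ℂ] K) ≃ₗᵢ[ℂ] (H ⊗[ℂ] K)
  U_isPropagator : IsPropagator U (tensorId K hS + idTensor H hE + V).closure
  /-- the duration of the interaction -/
  τ : ℝ
  τ_pos : 0 < τ
  /-- the reference state of the subsystem -/
  ρE : K →L[ℂ] K
  ρE_isDensityOperator : IsDensityOperator ρE
  ρE_invariant : ∀ t x, freeU t (ρE x) = ρE (freeU t x)

attribute [instance] Interaction.instNormedAddCommGroup Interaction.instInnerProductSpace
  Interaction.instCompleteSpace

/-- The operator `exp (-i τ h) (ρ ⊗ ρE) exp (i τ h)` on `H ⊗ K`. -/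
noncomputable def Interaction.evolve {hS : H →ₗ[ℂ] H} (I : Interaction.{u, v} hS)
    (ρ : H →L[ℂ] H) : (H ⊗[ℂ] I.K) →L[ℂ] (H ⊗[ℂ] I.K) :=
  ((I.U I.τ).toContinuousLinearEquiv : (H ⊗[ℂ] I.K) →L[ℂ] (H ⊗[ℂ] I.K)) ∘L
    (TensorProduct.mapL ρ I.ρE) ∘L
    ((I.U I.τ).symm.toContinuousLinearEquiv : (H ⊗[ℂ] I.K) →L[ℂ] (H ⊗[ℂ] I.K))

/-- `L` is a reduced dynamics map of the small system with Hamiltonian `hS`: for some interaction,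
`L ρ = Tr_K [exp (-i τ h) (ρ ⊗ ρE) exp (i τ h)]` for every `ρ`. As `H` will be finite dimensional,
`H →L[ℂ] H` is the space of trace class operators on `H` (with an equivalent norm). -/
def IsReducedDynamicsMap (hS : H →ₗ[ℂ] H) (L : (H →L[ℂ] H) →L[ℂ] (H →L[ℂ] H)) : Prop :=
  ∃ I : Interaction.{u, v} hS, ∀ ρ : H →L[ℂ] H, HasPartialTrace (I.evolve ρ) (L ρ)

/-- The ergodicity condition (E): the spectrum of `L` on the unit circle consists of the single
eigenvalue `1`, and this eigenvalue is (algebraically) simple. -/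
def IsErgodic (L : (H →L[ℂ] H) →L[ℂ] (H →L[ℂ] H)) : Prop :=
  spectrum ℂ L ∩ Metric.sphere (0 : ℂ) 1 = {1} ∧
    Module.finrank ℂ
      (Module.End.maxGenEigenspace (L : (H →L[ℂ] H) →ₗ[ℂ] (H →L[ℂ] H)) 1) = 1

/-- The set of the reduced dynamics maps that satisfy (E). -/
def ergodicMaps (hS : H →ₗ[ℂ] H) : Set ((H →L[ℂ] H) →L[ℂ] (H →L[ℂ] H)) :=
  {L | IsReducedDynamicsMap.{u, v} hS L ∧ IsErgodic L}

/-- States of the small (finite dimensional) system: positive operators with trace one. -/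
def IsState (ρ : H →L[ℂ] H) : Prop :=
  ρ.IsPositive ∧ LinearMap.trace ℂ H (ρ : H →ₗ[ℂ] H) = 1

/-- The state after `n` interactions: `(L ω_n ∘ ⋯ ∘ L ω_1) ρ`, for `ω = (ω_1, ω_2, …)`. -/
noncomputable def stateAt {Ω₀ : Type*} (L : Ω₀ → (H →L[ℂ] H) →L[ℂ] (H →L[ℂ] H)) (ω : ℕ+ → Ω₀)
    (ρ : H →L[ℂ] H) : ℕ → (H →L[ℂ] H)
  | 0 => ρ
  | n + 1 => L (ω n.succPNat) (stateAt L ω ρ n)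

end RepeatedInteraction

/-!
Write `F` for the mean of `L` and `V` for the space of operators of trace zero. Reduced dynamics
maps are positive and trace preserving. Such maps form a bounded monoid, so they are all
contractions for the norm `ρ ↦ sup ‖Φ ρ‖`, the supremum being over the monoid, and a map satisfies
(E) if and only if its powers tend to `0` on `V`.

The mean is a convex combination `q A + (1 - q) B` with `q > 0` and `A` arbitrarily close to a map
`L₀` satisfying (E). If `F x = z x` with `|z| ≥ 1` and `x ∈ V`, then expanding `F ^ m` into words in
the contractions `A` and `B` shows that `A ^ m`, hence `L₀ ^ m`, does not decrease the norm of `x`;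
as `L₀ ^ m x → 0`, this forces `x = 0`.

The increments `ρ(n + 1) - F ρ(n)` are bounded and pairwise orthogonal in `L²`, so that their
averages converge to zero almost surely. Since `1 - F` is injective on `V`, the averages of
`ρ(n) - ρ_{S,+} ∈ V` converge to zero too.
-/

namespace RepeatedInteraction

/-! ### Stability on a subspace and the ergodicity condition -/

section GeneralizedEigenspaces

open Module

variable {K M : Type*} [Field K] [AddCommGroup M] [Module K M] {T : End K M} {f : Dual K M} {μ : K}

theorem eq_zero_of_mem_maxGenEigenspace (hfT : ∀ x, f (T x) = μ * f x)
    (h : ∀ x, f x = 0 → T x = μ • x → x = 0) {y : M} (hy : y ∈ T.maxGenEigenspace μ)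
    (hfy : f y = 0) : y = 0 := by
  obtain ⟨k, hk⟩ := (End.mem_maxGenEigenspace T μ y).1 hy
  induction k generalizing y with
  | zero => exact hk
  | succ k ih =>
    have hDy : (T - μ • 1) y = 0 := by
      rw [pow_succ, Module.End.mul_apply] at hk
      exact ih ((End.mem_maxGenEigenspace T μ _).2 ⟨k, hk⟩) (by simp [hfT]) hk
    exact h y hfy (sub_eq_zero.1 hDy)

variable [FiniteDimensional K M]

theorem exists_mem_maxGenEigenspace_apply_ne_zero (hf : f ≠ 0) (hfT : ∀ x, f (T x) = μ * f x) :
    ∃ y ∈ T.maxGenEigenspace μ, f y ≠ 0 := by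
  by_contra! hgen
  obtain ⟨n, hn, hn1⟩ := ((T - μ • 1).eventually_isCompl_ker_pow_range_pow.and
    (eventually_ge_atTop 1)).exists
  -- By the Fitting decomposition, `f` would vanish both on a kernel and on a complementary range.
  refine hf (LinearMap.ker_eq_top.1 (top_le_iff.1 (hn.sup_eq_top ▸ sup_le ?_ ?_)))
  · exact fun y hy => hgen y ((End.mem_maxGenEigenspace T μ y).2 ⟨n, hy⟩)
  · rintro _ ⟨y, rfl⟩
    obtain ⟨k, rfl⟩ := Nat.exists_eq_add_of_le' hn1
    simp [pow_succ', hfT]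

theorem finrank_maxGenEigenspace_eq_one_iff (hf : f ≠ 0) (hfT : ∀ x, f (T x) = μ * f x) :
    finrank K (T.maxGenEigenspace μ) = 1 ↔ ∀ x, f x = 0 → T x = μ • x → x = 0 := by
  set G := T.maxGenEigenspace μ
  obtain ⟨y, hyG, hy⟩ := exists_mem_maxGenEigenspace_apply_ne_zero hf hfT
  have hfG : f.domRestrict G ≠ 0 := fun h => hy (LinearMap.congr_fun h ⟨y, hyG⟩)
  rw [← Dual.finrank_ker_add_one_of_ne_zero hfG, Nat.add_eq_right, Submodule.finrank_eq_zero,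
    LinearMap.ker_eq_bot']
  constructor
  · intro h x hfx hTx
    have hxG : x ∈ G := (End.mem_maxGenEigenspace T μ x).2 ⟨1, by simp [hTx]⟩
    exact congrArg Subtype.val (h ⟨x, hxG⟩ hfx)
  · exact fun h x hx => Subtype.ext (eq_zero_of_mem_maxGenEigenspace hfT h x.2 hx)

theorem exists_eigenvector_apply_eq_one (hf : f ≠ 0) (hfT : ∀ x, f (T x) = μ * f x)
    (h : ∀ x, f x = 0 → T x = μ • x → x = 0) : ∃ y, T y = μ • y ∧ f y = 1 := by
  obtain ⟨y, hyG, hy⟩ := exists_mem_maxGenEigenspace_apply_ne_zero hf hfT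
  have hDy : T y - μ • y = 0 := eq_zero_of_mem_maxGenEigenspace hfT h
    (sub_mem (End.mapsTo_maxGenEigenspace_of_comm (Commute.refl T) μ hyG)
      (Submodule.smul_mem _ _ hyG)) (by simp [hfT])
  refine ⟨(f y)⁻¹ • y, ?_, by simp [hy]⟩
  rw [map_smul, sub_eq_zero.1 hDy, smul_comm]

end GeneralizedEigenspaces

theorem tendsto_pow_zero_of_spectralRadius_lt_one {A : Type*} [NormedRing A] [NormedAlgebra ℂ A]
    [CompleteSpace A] {a : A} (ha : spectralRadius ℂ a < 1) :
    Tendsto (fun n : ℕ => a ^ n) atTop (𝓝 0) := by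
  obtain ⟨r, har, hr1⟩ := ENNReal.lt_iff_exists_nnreal_btwn.1 ha
  have hroot :=
    (spectrum.pow_nnnorm_pow_one_div_tendsto_nhds_spectralRadius a).eventually_lt_const har
  refine squeeze_zero_norm' ?_
    (tendsto_pow_atTop_nhds_zero_of_lt_one r.2 (by exact_mod_cast hr1))
  filter_upwards [hroot, eventually_ne_atTop 0] with n hn hn0
  rw [one_div, ENNReal.rpow_inv_lt_iff (by positivity), ENNReal.rpow_natCast] at hn
  exact_mod_cast hn.le

section Stability

variable {E : Type*} [NormedAddCommGroup E] [NormedSpace ℂ E] {T : E →L[ℂ] E} {V : Submodule ℂ E}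

/-- `T` is stable on the subspace `V`: its iterates converge to `0` there. On a finite-dimensional
invariant subspace this says that the restriction of `T` has spectral radius less than one. -/
def IsStableOn (T : E →L[ℂ] E) (V : Submodule ℂ E) : Prop :=
  ∀ x ∈ V, Tendsto (fun n : ℕ => (T ^ n) x) atTop (𝓝 0)

theorem pow_apply_eq_smul {z : ℂ} {x : E} (hx : T x = z • x) (n : ℕ) :
    (T ^ n) x = z ^ n • x := by
  induction n with
  | zero => simp
  | succ n ih =>
    rw [pow_succ, mul_apply_eq_comp, hx, map_smul, ih, smul_smul, pow_succ']

theorem IsStableOn.eq_zero_of_apply_eq_smul (hT : IsStableOn T V) {z : ℂ} (hz : 1 ≤ ‖z‖) {x : E}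
    (hxV : x ∈ V) (hx : T x = z • x) : x = 0 := by
  refine norm_le_zero_iff.1 (ge_of_tendsto' (tendsto_zero_iff_norm_tendsto_zero.1 (hT x hxV))
    fun n => ?_)
  rw [pow_apply_eq_smul hx, norm_smul, norm_pow]
  exact le_mul_of_one_le_left (norm_nonneg x) (one_le_pow₀ hz)

theorem IsStableOn.eq_zero_of_fixed (hT : IsStableOn T V) {x : E} (hxV : x ∈ V) (hx : T x = x) :
    x = 0 :=
  hT.eq_zero_of_apply_eq_smul (z := 1) (by simp) hxV (by simpa using hx)

variable [FiniteDimensional ℂ E]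

theorem mem_spectrum_iff_exists_eigenvector {z : ℂ} :
    z ∈ spectrum ℂ T ↔ ∃ x, x ≠ 0 ∧ T x = z • x := by
  have : CompleteSpace E := FiniteDimensional.complete ℂ E
  rw [ContinuousLinearMap.spectrum_eq, ← Module.End.hasEigenvalue_iff_mem_spectrum]
  constructor
  · intro hz
    obtain ⟨x, hx⟩ := hz.exists_hasEigenvector
    exact ⟨x, hx.2, hx.apply_eq_smul⟩
  · rintro ⟨x, hx0, hx⟩
    exact Module.End.hasEigenvalue_of_hasEigenvector ⟨Module.End.mem_eigenspace_iff.2 hx, hx0⟩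

theorem tendsto_pow_zero_of_forall_eigenvector (h : ∀ (z : ℂ) x, 1 ≤ ‖z‖ → T x = z • x → x = 0) :
    Tendsto (fun n : ℕ => T ^ n) atTop (𝓝 0) := by
  have : CompleteSpace E := FiniteDimensional.complete ℂ E
  rcases subsingleton_or_nontrivial E with hE | hE
  · exact tendsto_const_nhds.congr fun n => Subsingleton.elim _ _
  refine tendsto_pow_zero_of_spectralRadius_lt_one ?_
  refine mod_cast spectrum.spectralRadius_lt_of_forall_lt T (r := 1) fun z hz => ?_
  obtain ⟨x, hx0, hx⟩ := mem_spectrum_iff_exists_eigenvector.1 hz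
  by_contra! hz1
  exact hx0 (h z x hz1 hx)

theorem isStableOn_of_forall_eigenvector (hV : ∀ x ∈ V, T x ∈ V)
    (h : ∀ (z : ℂ), ∀ x ∈ V, 1 ≤ ‖z‖ → T x = z • x → x = 0) : IsStableOn T V := by
  let TV : V →L[ℂ] V := T.restrict hV
  have hpow : ∀ (n : ℕ) (y : V), ((TV ^ n) y : E) = (T ^ n) y := by
    intro n y
    induction n generalizing y with
    | zero => rfl
    | succ n ih => rw [pow_succ, pow_succ]; exact ih (TV y)
  have hlim : Tendsto (fun n : ℕ => TV ^ n) atTop (𝓝 0) :=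
    tendsto_pow_zero_of_forall_eigenvector fun z y hz hy =>
      Subtype.ext (h z y y.2 hz (congrArg Subtype.val hy))
  intro x hx
  have hcont : Continuous fun Φ : V →L[ℂ] V => (Φ ⟨x, hx⟩ : E) := by fun_prop
  exact ((hcont.tendsto 0).comp hlim).congr fun n => hpow n ⟨x, hx⟩

end Stability

section OrbitSeminorm

variable {E : Type*} [NormedAddCommGroup E] [NormedSpace ℂ E] {S : Submonoid (E →L[ℂ] E)}
  {A B T : E →L[ℂ] E}

/-- The supremum of the norm along the orbit under a monoid `S` of operators. For a bounded `S`
this is a norm equivalent to the original one and contracted by all elements of `S`. -/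
noncomputable def orbitSeminorm (S : Submonoid (E →L[ℂ] E)) : Seminorm ℂ E :=
  ⨆ Φ : S, (normSeminorm ℂ E).comp (Φ : E →L[ℂ] E).toLinearMap

theorem bddAbove_range_orbitSeminorm (hS : Bornology.IsBounded (S : Set (E →L[ℂ] E))) :
    BddAbove (Set.range fun Φ : S => (normSeminorm ℂ E).comp (Φ : E →L[ℂ] E).toLinearMap) := by
  obtain ⟨C, hC⟩ := isBounded_iff_forall_norm_le.1 hS
  refine Seminorm.bddAbove_range_iff.2 fun x => ⟨C * ‖x‖, ?_⟩
  rintro _ ⟨Φ, rfl⟩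
  exact (Φ : E →L[ℂ] E).le_of_opNorm_le (hC Φ Φ.2) x

theorem orbitSeminorm_apply (hS : Bornology.IsBounded (S : Set (E →L[ℂ] E))) (x : E) :
    orbitSeminorm S x = ⨆ Φ : S, ‖(Φ : E →L[ℂ] E) x‖ :=
  Seminorm.iSup_apply (bddAbove_range_orbitSeminorm hS)

theorem norm_apply_le_orbitSeminorm (hS : Bornology.IsBounded (S : Set (E →L[ℂ] E)))
    (hT : T ∈ S) (x : E) : ‖T x‖ ≤ orbitSeminorm S x := by
  rw [orbitSeminorm_apply hS]
  exact le_ciSup (Seminorm.bddAbove_range_iff.1 (bddAbove_range_orbitSeminorm hS) x) ⟨T, hT⟩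

theorem norm_le_orbitSeminorm (hS : Bornology.IsBounded (S : Set (E →L[ℂ] E))) (x : E) :
    ‖x‖ ≤ orbitSeminorm S x :=
  norm_apply_le_orbitSeminorm hS S.one_mem x

theorem orbitSeminorm_apply_le (hS : Bornology.IsBounded (S : Set (E →L[ℂ] E))) (hT : T ∈ S)
    (x : E) : orbitSeminorm S (T x) ≤ orbitSeminorm S x := by
  rw [orbitSeminorm_apply hS (T x)]
  exact ciSup_le fun Φ => norm_apply_le_orbitSeminorm hS (S.mul_mem Φ.2 hT) x

theorem continuous_orbitSeminorm [CompleteSpace E]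
    (hS : Bornology.IsBounded (S : Set (E →L[ℂ] E))) : Continuous (orbitSeminorm S) := by
  rw [orbitSeminorm, Seminorm.coe_iSup_eq (bddAbove_range_orbitSeminorm hS)]
  exact Seminorm.continuous_iSup _ (fun Φ : S => (Φ : E →L[ℂ] E).continuous.norm)
    (bddAbove_range_orbitSeminorm hS)

theorem norm_le_one_of_apply_eq_smul (hS : Bornology.IsBounded (S : Set (E →L[ℂ] E)))
    (hT : T ∈ S) {z : ℂ} {x : E} (hx0 : x ≠ 0) (hx : T x = z • x) : ‖z‖ ≤ 1 := by
  have hcontr := orbitSeminorm_apply_le hS hT x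
  rw [hx, map_smul_eq_mul] at hcontr
  exact (mul_le_iff_le_one_left ((norm_pos_iff.2 hx0).trans_le (norm_le_orbitSeminorm hS x))).1
    hcontr

/-- Among the words of length `m` in `A` and `B`, the word `A ^ m` has weight `q ^ m`; the other
words are contractions. -/
theorem orbitSeminorm_convexCombination_pow_le (hS : Bornology.IsBounded (S : Set (E →L[ℂ] E)))
    (hA : A ∈ S) (hB : B ∈ S) (hT : T ∈ S) {q : ℝ} (hq0 : 0 ≤ q) (hq1 : q ≤ 1)
    (hTAB : T = q • A + (1 - q) • B) (m : ℕ) (x : E) :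
    orbitSeminorm S ((T ^ m) x) ≤
      q ^ m * orbitSeminorm S ((A ^ m) x) + (1 - q ^ m) * orbitSeminorm S x := by
  induction m generalizing x with
  | zero => simp
  | succ m ih =>
    have hq1' : 0 ≤ 1 - q := sub_nonneg.2 hq1
    have hqm : 0 ≤ 1 - q ^ m := sub_nonneg.2 (pow_le_one₀ hq0 hq1)
    have hsplit : (T ^ (m + 1)) x =
        (q : ℂ) • (T ^ m) (A x) + ((1 - q : ℝ) : ℂ) • (T ^ m) (B x) := by
      have hTx : T x = (q : ℂ) • A x + ((1 - q : ℝ) : ℂ) • B x := congr($hTAB x)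
      rw [← map_smul (T ^ m), ← map_smul (T ^ m), ← map_add, ← hTx, pow_succ]
      rfl
    have hBx : orbitSeminorm S ((T ^ m) (B x)) ≤ orbitSeminorm S x :=
      (orbitSeminorm_apply_le hS (S.pow_mem hT m) _).trans (orbitSeminorm_apply_le hS hB x)
    have hAx : orbitSeminorm S ((T ^ m) (A x)) ≤
        q ^ m * orbitSeminorm S ((A ^ (m + 1)) x) + (1 - q ^ m) * orbitSeminorm S x := by
      have hAm : (A ^ (m + 1)) x = (A ^ m) (A x) := by rw [pow_succ]; rfl
      rw [hAm]
      exact (ih (A x)).trans (by gcongr; exact orbitSeminorm_apply_le hS hA x)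
    calc orbitSeminorm S ((T ^ (m + 1)) x)
        ≤ q * orbitSeminorm S ((T ^ m) (A x)) + (1 - q) * orbitSeminorm S ((T ^ m) (B x)) := by
          rw [hsplit]
          refine (map_add_le_add _ _ _).trans_eq ?_
          rw [map_smul_eq_mul, map_smul_eq_mul, Complex.norm_of_nonneg hq0,
            Complex.norm_of_nonneg hq1']
      _ ≤ q * (q ^ m * orbitSeminorm S ((A ^ (m + 1)) x) + (1 - q ^ m) * orbitSeminorm S x)
          + (1 - q) * orbitSeminorm S x := by gcongr
      _ = _ := by ring

theorem orbitSeminorm_le_pow_apply_of_convexCombination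
    (hS : Bornology.IsBounded (S : Set (E →L[ℂ] E))) (hA : A ∈ S) (hB : B ∈ S) (hT : T ∈ S)
    {q : ℝ} (hq0 : 0 < q) (hq1 : q ≤ 1) (hTAB : T = q • A + (1 - q) • B) {z : ℂ} (hz : 1 ≤ ‖z‖)
    {x : E} (hx : T x = z • x) (m : ℕ) : orbitSeminorm S x ≤ orbitSeminorm S ((A ^ m) x) := by
  have hle : orbitSeminorm S x ≤
      q ^ m * orbitSeminorm S ((A ^ m) x) + (1 - q ^ m) * orbitSeminorm S x := by
    refine le_trans ?_ (orbitSeminorm_convexCombination_pow_le hS hA hB hT hq0.le hq1 hTAB m x)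
    rw [pow_apply_eq_smul hx, map_smul_eq_mul, norm_pow]
    exact le_mul_of_one_le_left (apply_nonneg _ x) (one_le_pow₀ hz)
  exact le_of_mul_le_mul_left (by linarith) (pow_pos hq0 m)

end OrbitSeminorm

section ErgodicityCondition

variable {E : Type*} [NormedAddCommGroup E] [NormedSpace ℂ E] [FiniteDimensional ℂ E]
  {S : Submonoid (E →L[ℂ] E)} {T : E →L[ℂ] E} {f : Module.Dual ℂ E}

theorem isStableOn_ker_iff (hS : Bornology.IsBounded (S : Set (E →L[ℂ] E))) (hT : T ∈ S)
    (hf : f ≠ 0) (hfT : ∀ x, f (T x) = f x) :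
    IsStableOn T (LinearMap.ker f) ↔
      spectrum ℂ T ∩ Metric.sphere (0 : ℂ) 1 = {1} ∧
        Module.finrank ℂ (Module.End.maxGenEigenspace (T : E →ₗ[ℂ] E) 1) = 1 := by
  have hfT' : ∀ x, f ((T : E →ₗ[ℂ] E) x) = 1 * f x := fun x => by simpa using hfT x
  rw [finrank_maxGenEigenspace_eq_one_iff hf hfT']
  constructor
  · intro hstable
    have hfix : ∀ x, f x = 0 → (T : E →ₗ[ℂ] E) x = (1 : ℂ) • x → x = 0 := fun x hfx hx =>
      hstable.eq_zero_of_apply_eq_smul (by simp) hfx hx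
    obtain ⟨y, hTy, hfy⟩ := exists_eigenvector_apply_eq_one hf hfT' hfix
    have hy0 : y ≠ 0 := by rintro rfl; simp at hfy
    refine ⟨Set.Subset.antisymm ?_ ?_, hfix⟩
    · rintro z ⟨hz, hz1⟩
      obtain ⟨x, hx0, hx⟩ := mem_spectrum_iff_exists_eigenvector.1 hz
      have hfx : f x ≠ 0 := fun hfx => hx0
        (hstable.eq_zero_of_apply_eq_smul (mem_sphere_zero_iff_norm.1 hz1).ge hfx hx)
      refine (mul_eq_right₀ hfx).1 ?_
      rw [← smul_eq_mul, ← map_smul, ← hx, hfT]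
    · rintro _ rfl
      exact ⟨mem_spectrum_iff_exists_eigenvector.2 ⟨y, hy0, hTy⟩, by simp⟩
  · rintro ⟨hsphere, hfix⟩
    refine isStableOn_of_forall_eigenvector (fun x hx => (hfT x).trans hx) fun z x hxV hz hx => ?_
    by_contra hx0
    have hz1 : z ∈ spectrum ℂ T ∩ Metric.sphere (0 : ℂ) 1 :=
      ⟨mem_spectrum_iff_exists_eigenvector.2 ⟨x, hx0, hx⟩, mem_sphere_zero_iff_norm.2
        (le_antisymm (norm_le_one_of_apply_eq_smul hS hT hx0 hx) hz)⟩
    obtain rfl : z = 1 := by rwa [hsphere] at hz1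
    exact hx0 (hfix x hxV hx)

theorem IsStableOn.exists_fixed_apply_eq_one (hT : IsStableOn T (LinearMap.ker f)) (hf : f ≠ 0)
    (hfT : ∀ x, f (T x) = f x) : ∃ y, T y = y ∧ f y = 1 := by
  obtain ⟨y, hTy, hfy⟩ := exists_eigenvector_apply_eq_one (T := (T : E →ₗ[ℂ] E)) (μ := 1) hf
    (fun x => by simpa using hfT x) fun x hfx hx =>
      hT.eq_zero_of_apply_eq_smul (z := 1) (by simp) hfx hx
  exact ⟨y, by simpa using hTy, hfy⟩

end ErgodicityCondition

section Mean

variable {X Ω : Type*} [NormedAddCommGroup X] [MeasurableSpace Ω] {p : Measure Ω}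
  [IsProbabilityMeasure p] {g : Ω → X} {s : Set X}

theorem integrable_of_isBounded [MeasurableSpace X] [BorelSpace X] [SecondCountableTopology X]
    (hs : Bornology.IsBounded s) (hg : Measurable g) (hgs : ∀ ω, g ω ∈ s) : Integrable g p :=
  have ⟨C, hC⟩ := isBounded_iff_forall_norm_le.1 hs
  Integrable.of_bound hg.aestronglyMeasurable C (ae_of_all _ fun ω => hC _ (hgs ω))

variable [NormedSpace ℝ X] [CompleteSpace X]

theorem integral_eq_convexCombination_setAverage (hs : Convex ℝ s) (hsc : IsClosed s)
    (hg : Integrable g p) (hgs : ∀ ω, g ω ∈ s) {t : Set Ω} (ht : MeasurableSet t) :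
    ∃ B ∈ s, ∫ ω, g ω ∂p = p.real t • (⨍ ω in t, g ω ∂p) + (1 - p.real t) • B := by
  rw [← integral_add_compl ht hg, ← measure_smul_setAverage g (measure_ne_top p t)]
  by_cases hc : p tᶜ = 0
  · have ht1 : p.real t = 1 := by
      rw [measureReal_def, (prob_compl_eq_zero_iff ht).1 hc, ENNReal.toReal_one]
    refine ⟨∫ ω, g ω ∂p, hs.integral_mem hsc (ae_of_all _ hgs) hg, ?_⟩
    rw [Measure.restrict_eq_zero.2 hc, integral_zero_measure, ht1, sub_self, zero_smul]
  · refine ⟨⨍ ω in tᶜ, g ω ∂p, ?_, ?_⟩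
    · exact hs.set_average_mem hsc hc (measure_ne_top p _) (ae_of_all _ hgs) hg.integrableOn
    · rw [← measure_smul_setAverage g (measure_ne_top p tᶜ), probReal_compl_eq_one_sub ht]

variable [MeasurableSpace X] [BorelSpace X] [SecondCountableTopology X]

/-- `x₀` is a point of the support of the law of `g`, and `A` the average of `g` over the event
that it is close to `x₀`. -/
theorem exists_integral_eq_convexCombination_near (hs : Convex ℝ s) (hsc : IsClosed s)
    (hgm : Measurable g) (hg : Integrable g p) (hgs : ∀ ω, g ω ∈ s) {u : Set X}
    (hu : p (g ⁻¹' u) ≠ 0) :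
    ∃ x₀ ∈ u, ∀ ε > 0, ∃ A ∈ s, dist A x₀ ≤ ε ∧ ∃ B ∈ s, ∃ q : ℝ, 0 < q ∧ q ≤ 1 ∧
      ∫ ω, g ω ∂p = q • A + (1 - q) • B := by
  have hmap : p.map g u ≠ 0 :=
    ((pos_iff_ne_zero.2 hu).trans_le (Measure.le_map_apply hgm.aemeasurable u)).ne'
  obtain ⟨x₀, hx₀, hnhds⟩ := exists_mem_forall_mem_nhdsWithin_pos_measure hmap
  refine ⟨x₀, hx₀, fun ε hε => ?_⟩
  set t := g ⁻¹' Metric.closedBall x₀ ε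
  have htm : MeasurableSet t := hgm measurableSet_closedBall
  have ht : p t ≠ 0 := by
    rw [← Measure.map_apply hgm measurableSet_closedBall]
    exact (hnhds _ (mem_nhdsWithin_of_mem_nhds (Metric.closedBall_mem_nhds x₀ hε))).ne'
  obtain ⟨B, hB, hAB⟩ := integral_eq_convexCombination_setAverage hs hsc hg hgs htm
  refine ⟨⨍ ω in t, g ω ∂p, ?_, ?_, B, hB, p.real t, ?_, measureReal_le_one, hAB⟩
  · exact hs.set_average_mem hsc ht (measure_ne_top p t) (ae_of_all _ hgs) hg.integrableOn
  · exact (convex_closedBall x₀ ε).set_average_mem Metric.isClosed_closedBall ht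
      (measure_ne_top p t) (ae_restrict_of_forall_mem htm fun ω hω => hω) hg.integrableOn
  · exact ENNReal.toReal_pos ht (measure_ne_top p t)

end Mean

section MeanOperator

variable {E Ω : Type*} [NormedAddCommGroup E] [NormedSpace ℂ E] [FiniteDimensional ℂ E]
  {S : Submonoid (E →L[ℂ] E)} {V : Submodule ℂ E} [MeasurableSpace Ω] {p : Measure Ω}
  [IsProbabilityMeasure p] {L : Ω → E →L[ℂ] E}

/-- An eigenvector of the mean with eigenvalue of modulus at least one keeps its orbit norm under
the powers of every operator in the support of `L`, in particular under those of a stable one. -/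
theorem isStableOn_integral (hS : Bornology.IsBounded (S : Set (E →L[ℂ] E)))
    (hSconv : Convex ℝ (S : Set (E →L[ℂ] E))) (hSclosed : IsClosed (S : Set (E →L[ℂ] E)))
    (hSV : ∀ Φ ∈ S, ∀ x ∈ V, Φ x ∈ V) (hLm : Measurable L) (hL : ∀ ω, L ω ∈ S)
    (hpos : p {ω | IsStableOn (L ω) V} ≠ 0) : IsStableOn (∫ ω, L ω ∂p) V := by
  have : CompleteSpace E := FiniteDimensional.complete ℂ E
  have hLi : Integrable L p := integrable_of_isBounded hS hLm hL
  have hmean : ∫ ω, L ω ∂p ∈ S := hSconv.integral_mem hSclosed (ae_of_all _ hL) hLi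
  obtain ⟨L₀, hL₀, hnear⟩ := exists_integral_eq_convexCombination_near (u := {Φ | IsStableOn Φ V})
    hSconv hSclosed hLm hLi hL hpos
  choose! A hAS hAL₀ B hBS q hq0 hq1 hAB using hnear
  refine isStableOn_of_forall_eigenvector (hSV _ hmean) fun z x hxV hz hx => ?_
  have hAlim : Tendsto A (𝓝[>] 0) (𝓝 L₀) := tendsto_iff_dist_tendsto_zero.2 <|
    squeeze_zero' (Eventually.of_forall fun _ => dist_nonneg)
      (eventually_mem_nhdsWithin.mono hAL₀) (tendsto_nhdsWithin_of_tendsto_nhds tendsto_id)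
  have hpow : ∀ m : ℕ, orbitSeminorm S x ≤ orbitSeminorm S ((L₀ ^ m) x) := fun m => by
    have hcont : Continuous fun Φ : E →L[ℂ] E => orbitSeminorm S ((Φ ^ m) x) :=
      (continuous_orbitSeminorm hS).comp ((continuous_pow m).clm_apply continuous_const)
    refine ge_of_tendsto ((hcont.tendsto L₀).comp hAlim) ?_
    filter_upwards [eventually_mem_nhdsWithin] with ε hε
    exact orbitSeminorm_le_pow_apply_of_convexCombination hS (hAS ε hε) (hBS ε hε) hmean
      (hq0 ε hε) (hq1 ε hε) (hAB ε hε) hz hx m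
  have hzero := ((continuous_orbitSeminorm hS).tendsto 0).comp (hL₀ x hxV)
  rw [map_zero] at hzero
  exact norm_le_zero_iff.1 ((norm_le_orbitSeminorm hS x).trans (ge_of_tendsto' hzero hpow))

end MeanOperator

/-! ### A strong law of large numbers for orthogonal increments -/

section OrthogonalIncrements

variable {Ω : Type*} [MeasurableSpace Ω] {P : Measure Ω}

theorem ae_tendsto_zero_of_summable_integral {f : ℕ → Ω → ℝ} (hf : ∀ m, Integrable (f m) P)
    (hf0 : ∀ m ω, 0 ≤ f m ω) (hsum : Summable fun m => ∫ ω, f m ω ∂P) :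
    ∀ᵐ ω ∂P, Tendsto (fun m => f m ω) atTop (𝓝 0) := by
  have hfm : ∀ m, AEMeasurable (fun ω => ENNReal.ofReal (f m ω)) P := fun m =>
    (hf m).aemeasurable.ennreal_ofReal
  have hlint : ∫⁻ ω, ∑' m, ENNReal.ofReal (f m ω) ∂P ≠ ⊤ := by
    simpa only [lintegral_tsum hfm, ← ofReal_integral_eq_lintegral_ofReal (hf _)
      (ae_of_all _ (hf0 _))] using hsum.tsum_ofReal_ne_top
  filter_upwards [ae_lt_top' (AEMeasurable.tsum hfm) hlint] with ω hω
  refine ((ENNReal.tendsto_toReal ENNReal.zero_ne_top).comp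
    (ENNReal.tendsto_atTop_zero_of_tsum_ne_top hω.ne)).congr fun m => ?_
  exact ENNReal.toReal_ofReal (hf0 m ω)

theorem tendsto_natSqrt_atTop : Tendsto Nat.sqrt atTop atTop :=
  tendsto_atTop_atTop.2 fun b => ⟨b * b, fun _ ha => Nat.le_sqrt.2 ha⟩

/-- Between consecutive squares `m ^ 2 ≤ N ≤ m ^ 2 + 2 * m` at most `2 * m` bounded terms are
added. -/
theorem tendsto_average_of_tendsto_average_sq {G : Type*} [NormedAddCommGroup G] [NormedSpace ℝ G]
    {d : ℕ → G} {C : ℝ} (hC : ∀ n, ‖d n‖ ≤ C)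
    (h : Tendsto (fun m : ℕ => ((m : ℝ) ^ 2)⁻¹ * ‖∑ k ∈ Finset.range (m ^ 2), d k‖)
      atTop (𝓝 0)) :
    Tendsto (fun N : ℕ => (N : ℝ)⁻¹ • ∑ k ∈ Finset.range N, d k) atTop (𝓝 0) := by
  have hC0 : 0 ≤ C := (norm_nonneg _).trans (hC 0)
  have hbound : Tendsto (fun m : ℕ => ((m : ℝ) ^ 2)⁻¹ * ‖∑ k ∈ Finset.range (m ^ 2), d k‖
      + 2 * C * (m : ℝ)⁻¹) atTop (𝓝 0) := by
    simpa using h.add (tendsto_inv_atTop_nhds_zero_nat.const_mul (2 * C))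
  refine squeeze_zero_norm' ?_ (hbound.comp tendsto_natSqrt_atTop)
  filter_upwards [tendsto_natSqrt_atTop.eventually_gt_atTop 0] with N hN
  rw [Function.comp_apply]
  set m := Nat.sqrt N
  have hmN : m ^ 2 ≤ N := Nat.sqrt_le' N
  have hNm : N - m ^ 2 ≤ 2 * m := by grind [Nat.sqrt_le_add N]
  have : (0 : ℝ) < m := by exact_mod_cast hN
  have hmNR : (m : ℝ) ^ 2 ≤ N := by exact_mod_cast hmN
  have hgap : ‖∑ k ∈ Finset.Ico (m ^ 2) N, d k‖ ≤ 2 * m * C := by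
    refine (norm_sum_le_of_le _ fun k _ => hC k).trans ?_
    rw [Finset.sum_const, Nat.card_Ico, nsmul_eq_mul]
    gcongr
    exact_mod_cast hNm
  rw [norm_smul, norm_inv, Real.norm_natCast, ← Finset.sum_range_add_sum_Ico _ hmN]
  calc (N : ℝ)⁻¹ * ‖∑ k ∈ Finset.range (m ^ 2), d k + ∑ k ∈ Finset.Ico (m ^ 2) N, d k‖
      ≤ ((m : ℝ) ^ 2)⁻¹ * (‖∑ k ∈ Finset.range (m ^ 2), d k‖ + 2 * m * C) := by
        gcongr
        exact (norm_add_le _ _).trans (by gcongr)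
    _ = _ := by field_simp

variable {G : Type*} [NormedAddCommGroup G] [InnerProductSpace ℝ G]

theorem integrable_inner_of_norm_le [IsFiniteMeasure P] {X Y : Ω → G}
    (hX : AEStronglyMeasurable X P) (hY : AEStronglyMeasurable Y P) {a b : ℝ}
    (hXa : ∀ ω, ‖X ω‖ ≤ a) (hYb : ∀ ω, ‖Y ω‖ ≤ b) :
    Integrable (fun ω => inner ℝ (X ω) (Y ω)) P :=
  Integrable.of_bound (hX.inner hY) (a * b) (ae_of_all _ fun ω =>
    (norm_inner_le_norm _ _).trans (mul_le_mul (hXa ω) (hYb ω) (norm_nonneg _)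
      ((norm_nonneg _).trans (hXa ω))))

variable {D : ℕ → Ω → G} {C : ℝ}

theorem integrable_norm_sum_sq [IsFiniteMeasure P] (hDm : ∀ n, AEStronglyMeasurable (D n) P)
    (hDC : ∀ n ω, ‖D n ω‖ ≤ C) (n : ℕ) :
    Integrable (fun ω => ‖∑ k ∈ Finset.range n, D k ω‖ ^ 2) P := by
  have hm := Finset.aestronglyMeasurable_fun_sum (Finset.range n) fun k _ => hDm k
  have hC : ∀ ω, ‖∑ k ∈ Finset.range n, D k ω‖ ≤ ∑ _k ∈ Finset.range n, C := fun ω =>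
    norm_sum_le_of_le _ fun k _ => hDC k ω
  simpa only [real_inner_self_eq_norm_sq] using integrable_inner_of_norm_le hm hm hC hC

theorem integral_norm_sum_sq_of_orthogonal [IsFiniteMeasure P]
    (hDm : ∀ n, AEStronglyMeasurable (D n) P) (hDC : ∀ n ω, ‖D n ω‖ ≤ C)
    (horth : ∀ k n, k < n → ∫ ω, inner ℝ (D k ω) (D n ω) ∂P = 0)
    (n : ℕ) :
    ∫ ω, ‖∑ k ∈ Finset.range n, D k ω‖ ^ 2 ∂P = ∑ k ∈ Finset.range n, ∫ ω, ‖D k ω‖ ^ 2 ∂P := by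
  have hinner : ∀ k l, Integrable (fun ω => inner ℝ (D k ω) (D l ω)) P := fun k l =>
    integrable_inner_of_norm_le (hDm k) (hDm l) (hDC k) (hDC l)
  simp_rw [← real_inner_self_eq_norm_sq, sum_inner, inner_sum]
  rw [integral_finsetSum _ fun k _ => integrable_finsetSum _ fun l _ => hinner k l]
  refine Finset.sum_congr rfl fun k hk => ?_
  rw [integral_finsetSum _ fun l _ => hinner k l]
  refine Finset.sum_eq_single_of_mem k hk fun l _ hlk => ?_
  rcases hlk.lt_or_gt with h | h
  · simpa only [real_inner_comm] using horth l k h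
  · exact horth k l h

theorem integral_average_sq_le_of_orthogonal [IsProbabilityMeasure P]
    (hDm : ∀ n, AEStronglyMeasurable (D n) P)
    (hDC : ∀ n ω, ‖D n ω‖ ≤ C) (horth : ∀ k n, k < n → ∫ ω, inner ℝ (D k ω) (D n ω) ∂P = 0)
    (n : ℕ) : ∫ ω, ((n : ℝ)⁻¹ * ‖∑ k ∈ Finset.range n, D k ω‖) ^ 2 ∂P ≤ C ^ 2 * (n : ℝ)⁻¹ := by
  have hterm : ∀ k, ∫ ω, ‖D k ω‖ ^ 2 ∂P ≤ C ^ 2 := fun k => by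
    have hi : Integrable (fun ω => ‖D k ω‖ ^ 2) P := by
      simpa only [real_inner_self_eq_norm_sq] using
        integrable_inner_of_norm_le (hDm k) (hDm k) (hDC k) (hDC k)
    refine (integral_mono hi (integrable_const (C ^ 2)) fun ω => ?_).trans_eq (by simp)
    exact pow_le_pow_left₀ (norm_nonneg _) (hDC k ω) 2
  simp only [mul_pow]
  rw [integral_const_mul, integral_norm_sum_sq_of_orthogonal hDm hDC horth]
  calc ((n : ℝ)⁻¹) ^ 2 * ∑ k ∈ Finset.range n, ∫ ω, ‖D k ω‖ ^ 2 ∂P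
      ≤ ((n : ℝ)⁻¹) ^ 2 * ∑ _k ∈ Finset.range n, C ^ 2 := by gcongr with k; exact hterm k
    _ = C ^ 2 * (n : ℝ)⁻¹ := by
      rcases eq_or_ne n 0 with rfl | hn
      · simp
      · rw [Finset.sum_const, Finset.card_range, nsmul_eq_mul]
        field_simp

theorem ae_tendsto_average_of_orthogonal [IsProbabilityMeasure P]
    (hDm : ∀ n, AEStronglyMeasurable (D n) P)
    (hDC : ∀ n ω, ‖D n ω‖ ≤ C) (horth : ∀ k n, k < n → ∫ ω, inner ℝ (D k ω) (D n ω) ∂P = 0) :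
    ∀ᵐ ω ∂P, Tendsto (fun N : ℕ => (N : ℝ)⁻¹ • ∑ k ∈ Finset.range N, D k ω) atTop (𝓝 0) := by
  have hsummable : Summable fun m : ℕ =>
      ∫ ω, (((m ^ 2 : ℕ) : ℝ)⁻¹ * ‖∑ k ∈ Finset.range (m ^ 2), D k ω‖) ^ 2 ∂P := by
    refine Summable.of_nonneg_of_le (fun m => integral_nonneg fun ω => sq_nonneg _)
      (fun m => integral_average_sq_le_of_orthogonal hDm hDC horth (m ^ 2)) ?_
    simpa using (Real.summable_nat_pow_inv.2 one_lt_two).mul_left (C ^ 2)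
  have hsq := ae_tendsto_zero_of_summable_integral (P := P)
    (fun m => by simpa only [mul_pow] using (integrable_norm_sum_sq hDm hDC (m ^ 2)).const_mul _)
    (fun m ω => sq_nonneg _) hsummable
  filter_upwards [hsq] with ω hω
  refine tendsto_average_of_tendsto_average_sq (fun n => hDC n ω) ?_
  have hroot := hω.sqrt
  rw [Real.sqrt_zero] at hroot
  refine hroot.congr fun m => ?_
  rw [Real.sqrt_sq (by positivity), Nat.cast_pow]

end OrthogonalIncrements

section Resampling

variable {ι : Type*} [DecidableEq ι] {Ω : ι → Type*} [∀ i, MeasurableSpace (Ω i)]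
  (μ : ∀ i, Measure (Ω i)) [∀ i, IsProbabilityMeasure (μ i)]

theorem measurePreserving_update_infinitePi (i : ι) :
    MeasurePreserving (fun q : (∀ j, Ω j) × Ω i => Function.update q.1 i q.2)
      ((Measure.infinitePi μ).prod (μ i)) (Measure.infinitePi μ) := by
  refine ⟨measurable_update', Measure.eq_infinitePi _ fun s t ht => ?_⟩
  rw [Measure.map_apply measurable_update' (MeasurableSet.pi s.countable_toSet fun j _ => ht j)]
  set t' : Set (Ω i) := if i ∈ s then t i else Set.univ with ht'
  have hpre : (fun q : (∀ j, Ω j) × Ω i => Function.update q.1 i q.2) ⁻¹' Set.pi s t =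
      Set.pi (s.erase i : Finset ι) t ×ˢ t' := by
    ext q
    simp only [Set.mem_preimage, Set.mem_pi, Finset.mem_coe, Set.mem_prod, Finset.mem_erase]
    constructor
    · refine fun h => ⟨fun j hj => by simpa [hj.1] using h j hj.2, ?_⟩
      by_cases hi : i ∈ s
      · simpa [ht', hi] using h i hi
      · simp [ht', hi]
    · rintro ⟨h, hi⟩ j hj
      rcases eq_or_ne j i with rfl | hji
      · simpa [ht', hj] using hi
      · simpa [hji] using h j ⟨hji, hj⟩
  rw [hpre, Measure.prod_prod, Measure.infinitePi_pi _ fun j _ => ht j]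
  by_cases hi : i ∈ s
  · rw [ht', if_pos hi, Finset.prod_erase_mul _ _ hi]
  · rw [ht', if_neg hi, measure_univ, mul_one, Finset.erase_eq_of_notMem hi]

variable {μ}

theorem integral_inner_eq_zero_of_resampling {G : Type*} [NormedAddCommGroup G]
    [InnerProductSpace ℝ G] [CompleteSpace G] {X Y : (∀ j, Ω j) → G} (i : ι)
    (hXY : Integrable (fun ω => inner ℝ (X ω) (Y ω)) (Measure.infinitePi μ))
    (hX : ∀ ω x, X (Function.update ω i x) = X ω)
    (hYi : ∀ ω, Integrable (fun x => Y (Function.update ω i x)) (μ i))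
    (hY : ∀ ω, ∫ x, Y (Function.update ω i x) ∂μ i = 0) :
    ∫ ω, inner ℝ (X ω) (Y ω) ∂Measure.infinitePi μ = 0 := by
  have hmp := measurePreserving_update_infinitePi μ i
  have hXY' : AEStronglyMeasurable (fun ω => inner ℝ (X ω) (Y ω))
      (((Measure.infinitePi μ).prod (μ i)).map fun q => Function.update q.1 i q.2) := by
    rw [hmp.map_eq]
    exact hXY.aestronglyMeasurable
  have hcomp : Integrable (fun q : (∀ j, Ω j) × Ω i =>
      inner ℝ (X (Function.update q.1 i q.2)) (Y (Function.update q.1 i q.2)))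
      ((Measure.infinitePi μ).prod (μ i)) := hmp.integrable_comp_of_integrable hXY
  rw [← hmp.map_eq, integral_map hmp.aemeasurable hXY', integral_prod _ hcomp]
  simp only [hX, integral_inner (hYi _), hY, inner_zero_right, integral_zero]

theorem ae_tendsto_average_of_resampling {G : Type*} [NormedAddCommGroup G] [NormedSpace ℝ G]
    [FiniteDimensional ℝ G] [MeasurableSpace G] [BorelSpace G] {D : ℕ → (∀ j, Ω j) → G}
    (hDm : ∀ n, Measurable (D n)) {C : ℝ} (hDC : ∀ n ω, ‖D n ω‖ ≤ C) (i : ℕ → ι)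
    (hpast : ∀ k n, k < n → ∀ ω x, D k (Function.update ω (i n) x) = D k ω)
    (hmean : ∀ n ω, ∫ x, D n (Function.update ω (i n) x) ∂μ (i n) = 0) :
    ∀ᵐ ω ∂Measure.infinitePi μ,
      Tendsto (fun N : ℕ => (N : ℝ)⁻¹ • ∑ k ∈ Finset.range N, D k ω) atTop (𝓝 0) := by
  have : ProperSpace G := FiniteDimensional.proper ℝ G
  let e : G ≃L[ℝ] EuclideanSpace ℝ (Fin (Module.finrank ℝ G)) := toEuclidean
  have heDm : ∀ n, Measurable fun ω => e (D n ω) := fun n => e.continuous.measurable.comp (hDm n)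
  let e' : G →L[ℝ] EuclideanSpace ℝ (Fin (Module.finrank ℝ G)) := e
  have heDC : ∀ n ω, ‖e (D n ω)‖ ≤ ‖e'‖ * C := fun n ω => e'.le_opNorm_of_le (hDC n ω)
  have hDi : ∀ n ω, Integrable (fun x => D n (Function.update ω (i n) x)) (μ (i n)) := fun n ω =>
    Integrable.of_bound ((hDm n).comp (measurable_update ω)).aestronglyMeasurable C
      (ae_of_all _ fun x => hDC n _)
  have horth : ∀ k n, k < n →
      ∫ ω, inner ℝ (e (D k ω)) (e (D n ω)) ∂Measure.infinitePi μ = 0 := fun k n hkn => by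
    refine integral_inner_eq_zero_of_resampling (i n)
      (integrable_inner_of_norm_le (heDm k).aestronglyMeasurable (heDm n).aestronglyMeasurable
        (heDC k) (heDC n))
      (fun ω x => by rw [hpast k n hkn])
      (fun ω => e'.integrable_comp (hDi n ω)) fun ω => ?_
    rw [e.integral_comp_comm, hmean, map_zero]
  filter_upwards [ae_tendsto_average_of_orthogonal (fun n => (heDm n).aestronglyMeasurable) heDC
    horth] with ω hω
  have hback := (e.symm.continuous.tendsto 0).comp hω
  rw [map_zero] at hback
  exact hback.congr fun N => by simp

end Resampling

section RandomProduct

/-- The product `L (ω n) * ⋯ * L (ω 1)` of the first `n` factors; as in `stateAt`, each new factor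
multiplies on the left. -/
noncomputable def randomProduct {Ω A : Type*} [Monoid A] (L : Ω → A) (ω : ℕ+ → Ω) : ℕ → A
  | 0 => 1
  | n + 1 => L (ω n.succPNat) * randomProduct L ω n

theorem randomProduct_update {Ω A : Type*} [Monoid A] (L : Ω → A) (ω : ℕ+ → Ω) (x : Ω)
    {m n : ℕ} (hmn : m ≤ n) :
    randomProduct L (Function.update ω n.succPNat x) m = randomProduct L ω m := by
  induction m with
  | zero => rfl
  | succ m ih =>
    have hne : m.succPNat ≠ n.succPNat := Nat.succPNat_injective.ne (by omega)
    rw [randomProduct, randomProduct, ih (by omega), Function.update_of_ne hne]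

theorem randomProduct_mem {Ω A : Type*} [Monoid A] {S : Submonoid A} {L : Ω → A}
    (hL : ∀ x, L x ∈ S) (ω : ℕ+ → Ω) : ∀ n, randomProduct L ω n ∈ S
  | 0 => S.one_mem
  | n + 1 => S.mul_mem (hL _) (randomProduct_mem hL ω n)

variable {Ω : Type*} [MeasurableSpace Ω] {A : Type*}

theorem measurable_randomProduct [Monoid A] [MeasurableSpace A] [MeasurableMul₂ A] {L : Ω → A}
    (hL : Measurable L) (n : ℕ) : Measurable fun ω => randomProduct L ω n := by
  induction n with
  | zero => exact measurable_const
  | succ n ih => exact (hL.comp (measurable_pi_apply _)).mul ih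

/-- The increment `Π (n + 1) - F * Π n` has mean zero when only `ω (n + 1)` is averaged. -/
theorem ae_tendsto_average_increments_randomProduct [NormedRing A] [NormedAlgebra ℝ A]
    [FiniteDimensional ℝ A] [MeasurableSpace A] [BorelSpace A] {p : Measure Ω}
    [IsProbabilityMeasure p] {L : Ω → A} (hLm : Measurable L) {S : Submonoid A}
    (hS : Bornology.IsBounded (S : Set A)) (hL : ∀ x, L x ∈ S) :
    ∀ᵐ ω ∂Measure.infinitePi fun _ : ℕ+ => p, Tendsto (fun N : ℕ => (N : ℝ)⁻¹ •
      ∑ n ∈ Finset.range N, (randomProduct L ω (n + 1) - (∫ x, L x ∂p) * randomProduct L ω n))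
      atTop (𝓝 0) := by
  have : ProperSpace A := FiniteDimensional.proper ℝ A
  set F : A := ∫ x, L x ∂p
  obtain ⟨C, hC⟩ := isBounded_iff_forall_norm_le.1 hS
  have hPm := measurable_randomProduct hLm
  have hPC : ∀ ω n, ‖randomProduct L ω n‖ ≤ C := fun ω n => hC _ (randomProduct_mem hL ω n)
  refine ae_tendsto_average_of_resampling (C := C + ‖F‖ * C)
    (fun n => (hPm (n + 1)).sub ((hPm n).const_mul F)) (fun n ω => ?_) Nat.succPNat
    (fun k n hkn ω x => ?_) fun n ω => ?_
  · exact norm_sub_le_of_le (hPC ω (n + 1)) (norm_mul_le_of_le le_rfl (hPC ω n))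
  · rw [randomProduct_update L ω x hkn, randomProduct_update L ω x hkn.le]
  · have hLi : Integrable L p := integrable_of_isBounded hS hLm hL
    have hincr : ∀ x, randomProduct L (Function.update ω n.succPNat x) (n + 1) -
        F * randomProduct L (Function.update ω n.succPNat x) n =
          (L x - F) * randomProduct L ω n := fun x => by
      rw [randomProduct, randomProduct_update L ω x le_rfl, Function.update_self, sub_mul]
    simp only [hincr]
    have hLF : Integrable (fun x => L x - F) p := hLi.sub (integrable_const F)
    rw [integral_mul_const_of_integrable hLF,
      integral_sub hLi (integrable_const F), integral_const, probReal_univ, one_smul, sub_self,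
      zero_mul]

end RandomProduct

section Averages

variable {𝕜 E : Type*} [RCLike 𝕜] [NormedAddCommGroup E] [NormedSpace 𝕜 E]
  [FiniteDimensional 𝕜 E] {F : E →L[𝕜] E} {V : Submodule 𝕜 E}

theorem tendsto_zero_of_tendsto_sub_apply (hF : ∀ x ∈ V, F x = x → x = 0) {α : Type*}
    {l : Filter α} {x : α → E} (hxV : ∀ a, x a ∈ V)
    (hx : Tendsto (fun a => x a - F (x a)) l (𝓝 0)) : Tendsto x l (𝓝 0) := by
  let g : V →ₗ[𝕜] E := (LinearMap.id - (F : E →ₗ[𝕜] E)) ∘ₗ V.subtype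
  have hg : LinearMap.ker g = ⊥ := (Submodule.eq_bot_iff _).2 fun y hy =>
    Subtype.ext (hF y y.2 (sub_eq_zero.1 (LinearMap.mem_ker.1 hy)).symm)
  have hlim : Tendsto (fun a => (⟨x a, hxV a⟩ : V)) l (𝓝 0) := by
    rw [(LinearMap.isClosedEmbedding_of_injective hg).isInducing.tendsto_nhds_iff, map_zero]
    exact hx
  exact (continuous_subtype_val.tendsto 0).comp hlim

theorem tendsto_average_of_tendsto_average_increments (hF : ∀ x ∈ V, F x = x → x = 0)
    {r : ℕ → E} (hr : Bornology.IsBounded (Set.range r)) (hrV : ∀ n, r n ∈ V)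
    (hincr : Tendsto (fun N : ℕ => (N : 𝕜)⁻¹ • ∑ n ∈ Finset.range N, (r (n + 1) - F (r n)))
      atTop (𝓝 0)) :
    Tendsto (fun N : ℕ => (N : 𝕜)⁻¹ • ∑ n ∈ Finset.range N, r (n + 1)) atTop (𝓝 0) := by
  obtain ⟨C, hC⟩ := isBounded_iff_forall_norm_le.1 hr
  have hC' : ∀ n, ‖r n‖ ≤ C := fun n => hC _ (Set.mem_range_self n)
  have hshift : Tendsto (fun N : ℕ => (N : 𝕜)⁻¹ • (r N - r 0)) atTop (𝓝 0) :=
    NormedField.tendsto_zero_smul_of_tendsto_zero_of_bounded tendsto_inv_atTop_nhds_zero_nat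
      (isBoundedUnder_of ⟨C + C, fun N => norm_sub_le_of_le (hC' N) (hC' 0)⟩)
  have htelescope : ∀ N : ℕ, (N : 𝕜)⁻¹ • ∑ n ∈ Finset.range N, r (n + 1) =
      (N : 𝕜)⁻¹ • ∑ n ∈ Finset.range N, r n + (N : 𝕜)⁻¹ • (r N - r 0) := fun N => by
    rw [← smul_add, ← Finset.sum_range_sub, ← Finset.sum_add_distrib]
    simp only [add_sub_cancel]
  have hV : ∀ N : ℕ, (N : 𝕜)⁻¹ • ∑ n ∈ Finset.range N, r n ∈ V := fun N =>
    V.smul_mem _ (V.sum_mem fun n _ => hrV n)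
  have hlim : Tendsto (fun N : ℕ => (N : 𝕜)⁻¹ • ∑ n ∈ Finset.range N, r n) atTop (𝓝 0) := by
    refine tendsto_zero_of_tendsto_sub_apply hF hV ?_
    have hdiff := hincr.sub hshift
    rw [sub_zero] at hdiff
    refine hdiff.congr fun N => ?_
    rw [Finset.sum_sub_distrib, smul_sub, htelescope, map_smul, map_sum]
    abel
  simpa only [htelescope, add_zero] using hlim.add hshift

theorem tendsto_average_Icc_of_tendsto_average_sub {E : Type*} [NormedAddCommGroup E]
    [NormedSpace 𝕜 E] {r : ℕ → E} {y : E}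
    (h : Tendsto (fun N : ℕ => (N : 𝕜)⁻¹ • ∑ n ∈ Finset.range N, (r (n + 1) - y)) atTop (𝓝 0)) :
    Tendsto (fun N : ℕ => (N : 𝕜)⁻¹ • ∑ n ∈ Finset.Icc 1 N, r n) atTop (𝓝 y) := by
  rw [← tendsto_sub_nhds_zero_iff]
  refine h.congr' ?_
  filter_upwards [eventually_ne_atTop 0] with N hN
  have hN' : (N : 𝕜) ≠ 0 := Nat.cast_ne_zero.2 hN
  rw [Finset.sum_sub_distrib, smul_sub, Finset.sum_const, Finset.card_range,
    ← Nat.cast_smul_eq_nsmul 𝕜, inv_smul_smul₀ hN', Finset.range_eq_Ico,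
    Finset.sum_Ico_add' r 0 N 1]
  rfl

end Averages

/-! ### Reduced dynamics maps are positive and trace preserving -/

theorem tsum_enorm_sq_of_hasSum {ι G : Type*} [NormedAddCommGroup G] {f : ι → G} {t : ℂ}
    (hf : HasSum (fun k => (‖f k‖ : ℂ) ^ 2) t) :
    ∑' k, ‖f k‖ₑ ^ 2 = ENNReal.ofReal t.re := by
  have hre : HasSum (fun k => ‖f k‖ ^ 2) t.re := by
    simpa only [← Complex.ofReal_pow, Complex.ofReal_re] using Complex.hasSum_re hf
  rw [← hre.tsum_eq, ENNReal.ofReal_tsum_of_nonneg (fun _ => sq_nonneg _) hre.summable]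
  simp only [ENNReal.ofReal_pow (norm_nonneg _), ofReal_norm]

section HilbertSchmidt

variable {G G' : Type*} [NormedAddCommGroup G] [InnerProductSpace ℂ G]
  [NormedAddCommGroup G'] [InnerProductSpace ℂ G'] {ι κ : Type*}

/-- Families satisfying Parseval's identity. The tensor product of two Hilbert spaces is not
completed, so that Hilbert bases are not available there; the sum is taken in `ℝ≥0∞` so that double
sums may be exchanged. -/
def IsParseval (u : ι → G) : Prop :=
  ∀ z, ∑' k, ‖inner ℂ (u k) z‖ₑ ^ 2 = ‖z‖ₑ ^ 2

theorem IsParseval.map {u : ι → G} (hu : IsParseval u) (W : G ≃ₗᵢ[ℂ] G') :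
    IsParseval fun k => W (u k) := fun z => by
  simp only [LinearIsometryEquiv.inner_map_eq_flip, hu (W.symm z), W.symm.enorm_map]

theorem IsParseval.tsum_enorm_sq_eq {u : ι → G} {v : κ → G'} (hu : IsParseval u)
    (hv : IsParseval v) {T : G → G'} {T' : G' → G}
    (hT : ∀ x y, inner ℂ (T x) y = inner ℂ x (T' y)) :
    ∑' k, ‖T (u k)‖ₑ ^ 2 = ∑' l, ‖T' (v l)‖ₑ ^ 2 := by
  have hTl : ∀ k l, ‖inner ℂ (v l) (T (u k))‖ₑ = ‖inner ℂ (u k) (T' (v l))‖ₑ := fun k l => by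
    rw [← hT, ← inner_conj_symm, RCLike.enorm_conj]
  simp only [← hv (T _), ← hu (T' _), hTl]
  exact ENNReal.tsum_comm

theorem isParseval_hilbertBasis (b : HilbertBasis ι ℂ G) : IsParseval b := fun z => by
  have hsum : HasSum (fun k => (‖inner ℂ (b k) z‖ : ℂ) ^ 2) (inner ℂ z z) := by
    refine (b.hasSum_inner_mul_inner z z).congr_fun fun k => ?_
    rw [← inner_conj_symm z, Complex.conj_mul']
  rw [tsum_enorm_sq_of_hasSum hsum, ← RCLike.re_eq_complex_re, inner_self_eq_norm_sq,
    ENNReal.ofReal_pow (norm_nonneg _), ofReal_norm]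

end HilbertSchmidt

section TensorProduct

variable {H K : Type*} [NormedAddCommGroup H] [InnerProductSpace ℂ H]
  [NormedAddCommGroup K] [InnerProductSpace ℂ K]

theorem isParseval_tmul {ι κ : Type*} [Fintype ι] (e : OrthonormalBasis ι ℂ H) {v : κ → K}
    (hv : IsParseval v) : IsParseval fun k : ι × κ => e k.1 ⊗ₜ[ℂ] v k.2 := by
  classical
  intro z
  obtain ⟨c, rfl⟩ := TensorProduct.eq_repr_basis_left (N := K) e.toBasis z
  rw [Finsupp.sum_fintype _ _ fun i => TensorProduct.tmul_zero _ _]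
  simp only [OrthonormalBasis.coe_toBasis]
  have hinner : ∀ i (y : K), inner ℂ (e i ⊗ₜ[ℂ] y) (∑ l, e l ⊗ₜ[ℂ] c l) = inner ℂ y (c i) := by
    simp [inner_sum, orthonormal_iff_ite.mp e.orthonormal]
  have hnorm : ‖∑ l, e l ⊗ₜ[ℂ] c l‖ ^ 2 = ∑ l, ‖c l‖ ^ 2 := by
    rw [← inner_self_eq_norm_sq (𝕜 := ℂ), sum_inner, map_sum]
    simp only [hinner, inner_self_eq_norm_sq]
  rw [ENNReal.tsum_prod', tsum_fintype, ← ofReal_norm, ← ENNReal.ofReal_pow (norm_nonneg _), hnorm,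
    ENNReal.ofReal_sum_of_nonneg fun _ _ => sq_nonneg _]
  simp only [hinner, hv (c _), ENNReal.ofReal_pow (norm_nonneg _), ofReal_norm]

theorem inner_mapL_eq {A : H →L[ℂ] H} (hA : ∀ x y, inner ℂ (A x) y = inner ℂ x (A y))
    {B : K →L[ℂ] K} (hB : ∀ x y, inner ℂ (B x) y = inner ℂ x (B y)) (z w : H ⊗[ℂ] K) :
    inner ℂ (TensorProduct.mapL A B z) w = inner ℂ z (TensorProduct.mapL A B w) := by
  induction z with
  | zero => simp only [map_zero, inner_zero_left]
  | add z z' hz hz' => simp only [map_add, inner_add_left, hz, hz']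
  | tmul x y =>
    induction w with
    | zero => simp only [map_zero, inner_zero_right]
    | add w w' hw hw' => simp only [map_add, inner_add_right, hw, hw']
    | tmul x' y' => simp only [TensorProduct.mapL_tmul, TensorProduct.inner_tmul, hA, hB]

end TensorProduct

section SquareRoot

variable {E : Type*} [NormedAddCommGroup E] [InnerProductSpace ℂ E] [CompleteSpace E]
  {T : E →L[ℂ] E}

theorem inner_sqrt_apply (T : E →L[ℂ] E) (x y : E) :
    inner ℂ (CFC.sqrt T x) y = inner ℂ x (CFC.sqrt T y) :=
  ((ContinuousLinearMap.nonneg_iff_isPositive _).1 (CFC.sqrt_nonneg T)).isSymmetric x y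

theorem sqrt_mul_sqrt_of_isPositive (hT : T.IsPositive) : CFC.sqrt T * CFC.sqrt T = T :=
  CFC.sqrt_mul_sqrt_self T ((ContinuousLinearMap.nonneg_iff_isPositive T).2 hT)

theorem inner_apply_eq_norm_sqrt_sq (hT : T.IsPositive) (x : E) :
    inner ℂ x (T x) = (‖CFC.sqrt T x‖ : ℂ) ^ 2 := by
  conv_lhs => rw [← sqrt_mul_sqrt_of_isPositive hT]
  rw [mul_apply_eq_comp, ← inner_sqrt_apply]
  exact inner_self_eq_norm_sq_to_K _

theorem IsDensityOperator.tsum_enorm_sqrt_sq (hT : IsDensityOperator T) {w : Set E}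
    (b : HilbertBasis w ℂ E) : ∑' i, ‖CFC.sqrt T (b i)‖ₑ ^ 2 = 1 := by
  have hsum := hT.hasTrace_one w b
  simp only [inner_apply_eq_norm_sqrt_sq hT.isPositive] at hsum
  rw [tsum_enorm_sq_of_hasSum hsum, Complex.one_re, ENNReal.ofReal_one]

theorem tsum_enorm_sqrt_sq_eq_trace {ι : Type*} [Fintype ι] (e : OrthonormalBasis ι ℂ E)
    (hT : T.IsPositive) : ∑' j, ‖CFC.sqrt T (e j)‖ₑ ^ 2 =
      ENNReal.ofReal (LinearMap.trace ℂ E (T : E →ₗ[ℂ] E)).re := by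
  refine tsum_enorm_sq_of_hasSum ?_
  simp only [← inner_apply_eq_norm_sqrt_sq hT]
  rw [LinearMap.trace_eq_sum_inner _ e]
  exact hasSum_fintype _

end SquareRoot

section PartialTrace

open scoped ComplexOrder

variable {H K : Type*} [NormedAddCommGroup H] [InnerProductSpace ℂ H]
  [NormedAddCommGroup K] [InnerProductSpace ℂ K] {T : (H ⊗[ℂ] K) →L[ℂ] (H ⊗[ℂ] K)} {A : H →L[ℂ] H}

theorem isPositive_iff_forall_inner_nonneg :
    A.IsPositive ↔ ∀ x, 0 ≤ inner ℂ x (A x) := by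
  refine ⟨fun hA => hA.inner_nonneg_right, fun hA => ?_⟩
  refine (ContinuousLinearMap.isPositive_iff_complex A).2 fun x => ?_
  obtain ⟨hre, him⟩ := Complex.nonneg_iff.1 (hA x)
  rw [← inner_conj_symm, RCLike.re_eq_complex_re, Complex.conj_re]
  exact ⟨Complex.ext rfl (by simp only [Complex.ofReal_im, Complex.conj_im, ← him, neg_zero]), hre⟩

theorem HasPartialTrace.isPositive [CompleteSpace K] (hA : HasPartialTrace T A)
    (hT : T.IsPositive) : A.IsPositive := by
  obtain ⟨w, b, -⟩ := exists_hilbertBasis ℂ K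
  exact isPositive_iff_forall_inner_nonneg.2 fun x =>
    (hA w b x x).nonneg fun i => hT.inner_nonneg_right _

theorem HasPartialTrace.tsum_enorm_sq_eq_trace {ι G : Type*} [Fintype ι] [NormedAddCommGroup G]
    (hA : HasPartialTrace T A) {R : H ⊗[ℂ] K → G} (hTR : ∀ z, inner ℂ z (T z) = (‖R z‖ : ℂ) ^ 2)
    (e : OrthonormalBasis ι ℂ H) {w : Set K} (b : HilbertBasis w ℂ K) :
    ∑' k : ι × w, ‖R (e k.1 ⊗ₜ[ℂ] b k.2)‖ₑ ^ 2 =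
      ENNReal.ofReal (LinearMap.trace ℂ H (A : H →ₗ[ℂ] H)).re := by
  have hR : ∀ j, HasSum (fun i => (‖R (e j ⊗ₜ[ℂ] b i)‖ : ℂ) ^ 2) (inner ℂ (e j) (A (e j))) :=
    fun j => by simpa only [hTR] using hA w b (e j) (e j)
  have hnonneg : ∀ j, 0 ≤ (inner ℂ (e j) (A (e j))).re := fun j =>
    (Complex.nonneg_iff.1 ((hR j).nonneg fun i => by positivity)).1
  rw [ENNReal.tsum_prod', tsum_fintype, LinearMap.trace_eq_sum_inner _ e, Complex.re_sum]
  simp only [ContinuousLinearMap.coe_coe]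
  rw [ENNReal.ofReal_sum_of_nonneg fun j _ => hnonneg j]
  exact Finset.sum_congr rfl fun j _ => tsum_enorm_sq_of_hasSum (hR j)

end PartialTrace

section ReducedDynamics

open scoped ComplexOrder

variable {H : Type u} [NormedAddCommGroup H] [InnerProductSpace ℂ H]

/-- The trace as a linear functional on the operators on `H`, for finite-dimensional `H`: its kernel
is the space on which ergodic maps are stable. -/
noncomputable def operatorTrace (H : Type*) [NormedAddCommGroup H] [InnerProductSpace ℂ H] :
    Module.Dual ℂ (H →L[ℂ] H) :=
  LinearMap.trace ℂ H ∘ₗ ContinuousLinearMap.coeLM ℂ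

/-- The positive trace-preserving maps on the operators on `H`: a class containing all
reduced dynamics maps and, unlike these, visibly closed under composition and averaging. -/
noncomputable def positiveTracePreserving (H : Type*) [NormedAddCommGroup H]
    [InnerProductSpace ℂ H] : Submonoid ((H →L[ℂ] H) →L[ℂ] (H →L[ℂ] H)) where
  carrier := {Φ | (∀ ρ : H →L[ℂ] H, ρ.IsPositive → (Φ ρ).IsPositive) ∧
    ∀ ρ, operatorTrace H (Φ ρ) = operatorTrace H ρ}
  one_mem' := ⟨fun _ hρ => hρ, fun _ => rfl⟩
  mul_mem' hΦ hΨ :=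
    ⟨fun ρ hρ => hΦ.1 _ (hΨ.1 ρ hρ), fun ρ => (hΦ.2 _).trans (hΨ.2 ρ)⟩

theorem Interaction.inner_evolve [CompleteSpace H] {hS : H →ₗ[ℂ] H} (I : Interaction.{u, v} hS)
    {ρ : H →L[ℂ] H} (hρ : ρ.IsPositive) (z : H ⊗[ℂ] I.K) :
    inner ℂ z (I.evolve ρ z) =
      (‖TensorProduct.mapL (CFC.sqrt ρ) (CFC.sqrt I.ρE) ((I.U I.τ).symm z)‖ : ℂ) ^ 2 := by
  have hsq : TensorProduct.mapL ρ I.ρE = TensorProduct.mapL (CFC.sqrt ρ) (CFC.sqrt I.ρE) *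
      TensorProduct.mapL (CFC.sqrt ρ) (CFC.sqrt I.ρE) := by
    rw [← TensorProduct.mapL_mul, sqrt_mul_sqrt_of_isPositive hρ,
      sqrt_mul_sqrt_of_isPositive I.ρE_isDensityOperator.isPositive]
  have hevolve : I.evolve ρ z = I.U I.τ (TensorProduct.mapL ρ I.ρE ((I.U I.τ).symm z)) := rfl
  rw [hevolve, ← (I.U I.τ).symm.inner_map_map, LinearIsometryEquiv.symm_apply_apply, hsq,
    mul_apply_eq_comp, ← inner_mapL_eq (inner_sqrt_apply ρ) (inner_sqrt_apply I.ρE)]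
  exact inner_self_eq_norm_sq_to_K _

variable [FiniteDimensional ℂ H]

theorem IsReducedDynamicsMap.isPositive {hS : H →ₗ[ℂ] H} {L : (H →L[ℂ] H) →L[ℂ] (H →L[ℂ] H)}
    (hL : IsReducedDynamicsMap.{u, v} hS L) {ρ : H →L[ℂ] H} (hρ : ρ.IsPositive) :
    (L ρ).IsPositive := by
  have := FiniteDimensional.complete ℂ H
  obtain ⟨I, hI⟩ := hL
  refine (hI ρ).isPositive (isPositive_iff_forall_inner_nonneg.2 fun z => ?_)
  rw [I.inner_evolve hρ]
  positivity

theorem IsReducedDynamicsMap.trace_apply_of_isPositive {hS : H →ₗ[ℂ] H}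
    {L : (H →L[ℂ] H) →L[ℂ] (H →L[ℂ] H)} (hL : IsReducedDynamicsMap.{u, v} hS L) {ρ : H →L[ℂ] H}
    (hρ : ρ.IsPositive) :
    LinearMap.trace ℂ H (L ρ : H →ₗ[ℂ] H) = LinearMap.trace ℂ H (ρ : H →ₗ[ℂ] H) := by
  have := FiniteDimensional.complete ℂ H
  have hLρ := hL.isPositive hρ
  obtain ⟨I, hI⟩ := hL
  obtain ⟨w, b, -⟩ := exists_hilbertBasis ℂ I.K
  let e := stdOrthonormalBasis ℂ H
  have hbasis := isParseval_tmul e (isParseval_hilbertBasis b)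
  have hunitary := (hbasis.map (I.U I.τ).symm).tsum_enorm_sq_eq hbasis
    (inner_mapL_eq (inner_sqrt_apply ρ) (inner_sqrt_apply I.ρE))
  have hproduct : ∑' k : _ × w, ‖TensorProduct.mapL (CFC.sqrt ρ) (CFC.sqrt I.ρE)
      (e k.1 ⊗ₜ[ℂ] b k.2)‖ₑ ^ 2 = ENNReal.ofReal (LinearMap.trace ℂ H (ρ : H →ₗ[ℂ] H)).re := by
    simp only [TensorProduct.mapL_tmul, TensorProduct.enorm_tmul, mul_pow, ENNReal.tsum_prod',
      ENNReal.tsum_mul_left, I.ρE_isDensityOperator.tsum_enorm_sqrt_sq b, mul_one,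
      tsum_enorm_sqrt_sq_eq_trace e hρ]
  have htr := Complex.nonneg_iff.1 hρ.toLinearMap.trace_nonneg
  have htrL := Complex.nonneg_iff.1 hLρ.toLinearMap.trace_nonneg
  rw [hproduct, (hI ρ).tsum_enorm_sq_eq_trace (I.inner_evolve hρ) e b,
    ENNReal.ofReal_eq_ofReal_iff htrL.1 htr.1] at hunitary
  exact Complex.ext hunitary (htrL.2.symm.trans htr.2)

theorem IsReducedDynamicsMap.mem_positiveTracePreserving {hS : H →ₗ[ℂ] H}
    {L : (H →L[ℂ] H) →L[ℂ] (H →L[ℂ] H)} (hL : IsReducedDynamicsMap.{u, v} hS L) :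
    L ∈ positiveTracePreserving H := by
  have := FiniteDimensional.complete ℂ H
  have htrace : operatorTrace H ∘ₗ (L : (H →L[ℂ] H) →ₗ[ℂ] (H →L[ℂ] H)) = operatorTrace H :=
    LinearMap.ext_on (CStarAlgebra.span_nonneg (A := H →L[ℂ] H)) fun ρ hρ =>
      hL.trace_apply_of_isPositive ((ContinuousLinearMap.nonneg_iff_isPositive ρ).1 hρ)
  exact ⟨fun _ hρ => hL.isPositive hρ, LinearMap.congr_fun htrace⟩

end ReducedDynamics

section PositiveTracePreserving

open scoped ComplexOrder

variable {H : Type*} [NormedAddCommGroup H] [InnerProductSpace ℂ H] [FiniteDimensional ℂ H]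

theorem norm_le_re_trace {ρ : H →L[ℂ] H} (hρ : ρ.IsPositive) :
    ‖ρ‖ ≤ (LinearMap.trace ℂ H (ρ : H →ₗ[ℂ] H)).re := by
  have := FiniteDimensional.complete ℂ H
  let e := stdOrthonormalBasis ℂ H
  have htrace : (LinearMap.trace ℂ H (ρ : H →ₗ[ℂ] H)).re = ∑ j, ‖CFC.sqrt ρ (e j)‖ ^ 2 := by
    rw [LinearMap.trace_eq_sum_inner _ e, Complex.re_sum]
    simp only [ContinuousLinearMap.coe_coe, inner_apply_eq_norm_sqrt_sq hρ, ← Complex.ofReal_pow,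
      Complex.ofReal_re]
  have hnonneg : 0 ≤ ∑ j, ‖CFC.sqrt ρ (e j)‖ ^ 2 := Finset.sum_nonneg fun _ _ => sq_nonneg _
  have hsqrt : ‖CFC.sqrt ρ‖ ≤ √(∑ j, ‖CFC.sqrt ρ (e j)‖ ^ 2) := by
    refine ContinuousLinearMap.opNorm_le_bound _ (Real.sqrt_nonneg _) fun x => ?_
    rw [← Real.sqrt_sq (norm_nonneg x), ← Real.sqrt_mul hnonneg]
    refine Real.le_sqrt_of_sq_le ?_
    rw [← e.sum_sq_norm_inner_right, Finset.sum_mul]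
    refine Finset.sum_le_sum fun j _ => ?_
    rw [← inner_sqrt_apply, ← mul_pow]
    exact pow_le_pow_left₀ (norm_nonneg _) (norm_inner_le_norm _ _) 2
  calc ‖ρ‖ = ‖CFC.sqrt ρ * CFC.sqrt ρ‖ := by rw [sqrt_mul_sqrt_of_isPositive hρ]
    _ ≤ ‖CFC.sqrt ρ‖ * ‖CFC.sqrt ρ‖ := norm_mul_le _ _
    _ ≤ √(∑ j, ‖CFC.sqrt ρ (e j)‖ ^ 2) * √(∑ j, ‖CFC.sqrt ρ (e j)‖ ^ 2) := by gcongr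
    _ = (LinearMap.trace ℂ H (ρ : H →ₗ[ℂ] H)).re := by rw [Real.mul_self_sqrt hnonneg, htrace]

theorem isClosed_isPositive : IsClosed {ρ : H →L[ℂ] H | ρ.IsPositive} := by
  have := FiniteDimensional.complete ℂ H
  simpa only [ContinuousLinearMap.nonneg_iff_isPositive] using
    CStarAlgebra.isClosed_nonneg (A := H →L[ℂ] H)

theorem continuous_operatorTrace : Continuous (operatorTrace H) :=
  LinearMap.continuous_of_finiteDimensional _

theorem isClosed_positiveTracePreserving :
    IsClosed (positiveTracePreserving H : Set ((H →L[ℂ] H) →L[ℂ] (H →L[ℂ] H))) := by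
  have happly : ∀ ρ : H →L[ℂ] H, Continuous fun Φ : (H →L[ℂ] H) →L[ℂ] (H →L[ℂ] H) => Φ ρ :=
    fun ρ => by fun_prop
  change IsClosed {Φ : (H →L[ℂ] H) →L[ℂ] (H →L[ℂ] H) |
    (∀ ρ : H →L[ℂ] H, ρ.IsPositive → (Φ ρ).IsPositive) ∧
      ∀ ρ, operatorTrace H (Φ ρ) = operatorTrace H ρ}
  simp only [Set.ofPred_and, Set.ofPred_forall]
  exact (isClosed_iInter fun ρ => isClosed_iInter fun _ =>
    isClosed_isPositive.preimage (happly ρ)).inter (isClosed_iInter fun ρ =>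
      isClosed_eq (continuous_operatorTrace.comp (happly ρ)) continuous_const)

theorem convex_positiveTracePreserving :
    Convex ℝ (positiveTracePreserving H : Set ((H →L[ℂ] H) →L[ℂ] (H →L[ℂ] H))) := by
  intro Φ hΦ Ψ hΨ a b ha hb hab
  refine ⟨fun ρ hρ => ?_, fun ρ => ?_⟩
  · exact ((hΦ.1 ρ hρ).smul_of_nonneg (Complex.zero_le_real.2 ha)).add
      ((hΨ.1 ρ hρ).smul_of_nonneg (Complex.zero_le_real.2 hb))
  · calc operatorTrace H (a • Φ ρ + b • Ψ ρ)
        = a • operatorTrace H (Φ ρ) + b • operatorTrace H (Ψ ρ) := by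
          rw [map_add, LinearMap.map_smul_of_tower, LinearMap.map_smul_of_tower]
      _ = operatorTrace H ρ := by rw [hΦ.2 ρ, hΨ.2 ρ, ← add_smul, hab, one_smul]

theorem isBounded_positiveTracePreserving :
    Bornology.IsBounded (positiveTracePreserving H : Set ((H →L[ℂ] H) →L[ℂ] (H →L[ℂ] H))) := by
  have := FiniteDimensional.complete ℂ H
  let trace : (H →L[ℂ] H) →L[ℂ] ℂ := ⟨operatorTrace H, continuous_operatorTrace⟩
  refine isBounded_iff_forall_norm_le.2 ⟨4 * ‖trace‖, fun Φ hΦ => ?_⟩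
  refine Φ.opNorm_le_bound (by positivity) fun a => ?_
  obtain ⟨x, hx, hxa, hsum⟩ := CStarAlgebra.exists_sum_four_nonneg a
  have hΦx : ∀ i, ‖Φ (x i)‖ ≤ ‖trace‖ * ‖a‖ := fun i => by
    have hxi := (ContinuousLinearMap.nonneg_iff_isPositive _).1 (hx i)
    calc ‖Φ (x i)‖ ≤ (LinearMap.trace ℂ H (Φ (x i) : H →ₗ[ℂ] H)).re := norm_le_re_trace (hΦ.1 _ hxi)
      _ = (trace (x i)).re := congrArg Complex.re (hΦ.2 (x i))
      _ ≤ ‖trace (x i)‖ := Complex.re_le_norm _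
      _ ≤ ‖trace‖ * ‖a‖ := trace.le_opNorm_of_le (hxa i)
  calc ‖Φ a‖ = ‖∑ i : Fin 4, Complex.I ^ (i : ℕ) • Φ (x i)‖ := by
        conv_lhs => rw [hsum, map_sum]
        simp only [map_smul]
    _ ≤ ∑ _i : Fin 4, ‖trace‖ * ‖a‖ := norm_sum_le_of_le _ fun i _ => by
        rw [norm_smul, norm_pow, Complex.norm_I, one_pow, one_mul]
        exact hΦx i
    _ = 4 * ‖trace‖ * ‖a‖ := by
        rw [Finset.sum_const, Finset.card_univ, Fintype.card_fin, nsmul_eq_mul, mul_assoc]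
        norm_num

end PositiveTracePreserving

/-! ### States and their averages -/

section Ergodicity

open scoped ComplexOrder

variable {H : Type*} [NormedAddCommGroup H] [InnerProductSpace ℂ H]
  {Φ : (H →L[ℂ] H) →L[ℂ] (H →L[ℂ] H)}

theorem IsErgodic.nontrivial (hΦ : IsErgodic Φ) : Nontrivial H := by
  by_contra hH
  rw [not_nontrivial_iff_subsingleton] at hH
  have hzero := hΦ.2
  rw [Module.finrank_zero_of_subsingleton] at hzero
  exact zero_ne_one hzero

theorem IsState.sub_mem_ker_operatorTrace {ρ σ : H →L[ℂ] H} (hρ : IsState ρ) (hσ : IsState σ) :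
    ρ - σ ∈ LinearMap.ker (operatorTrace H) := by
  rw [LinearMap.mem_ker, map_sub, sub_eq_zero]
  exact hρ.2.trans hσ.2.symm

theorem IsState.apply {ρ : H →L[ℂ] H} (hρ : IsState ρ) (hΦ : Φ ∈ positiveTracePreserving H) :
    IsState (Φ ρ) :=
  ⟨hΦ.1 ρ hρ.1, (hΦ.2 ρ).trans hρ.2⟩

variable [FiniteDimensional ℂ H]

theorem operatorTrace_one : operatorTrace H 1 = Module.finrank ℂ H := LinearMap.trace_one ℂ H

theorem operatorTrace_ne_zero [Nontrivial H] : operatorTrace H ≠ 0 := fun h =>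
  Nat.cast_ne_zero.2 (Module.finrank_pos (R := ℂ) (M := H)).ne'
    ((operatorTrace_one (H := H)).symm.trans (LinearMap.congr_fun h 1))

theorem isState_maximallyMixed [Nontrivial H] :
    IsState ((Module.finrank ℂ H : ℂ)⁻¹ • (1 : H →L[ℂ] H)) := by
  refine ⟨ContinuousLinearMap.isPositive_one.smul_of_nonneg (by positivity), ?_⟩
  change operatorTrace H ((Module.finrank ℂ H : ℂ)⁻¹ • 1) = 1
  rw [map_smul, operatorTrace_one, smul_eq_mul]
  exact inv_mul_cancel₀ (Nat.cast_ne_zero.2 Module.finrank_pos.ne')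

theorem isErgodic_iff_isStableOn [Nontrivial H] (hΦ : Φ ∈ positiveTracePreserving H) :
    IsErgodic Φ ↔ IsStableOn Φ (LinearMap.ker (operatorTrace H)) :=
  (isStableOn_ker_iff isBounded_positiveTracePreserving hΦ operatorTrace_ne_zero hΦ.2).symm

theorem IsStableOn.existsUnique_isState_fixed [Nontrivial H] (hΦ : Φ ∈ positiveTracePreserving H)
    (hstable : IsStableOn Φ (LinearMap.ker (operatorTrace H))) :
    ∃! ρ, IsState ρ ∧ Φ ρ = ρ := by
  obtain ⟨ρ, hρ, htrace⟩ := hstable.exists_fixed_apply_eq_one operatorTrace_ne_zero hΦ.2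
  have hpow : ∀ n, (Φ ^ n) ρ = ρ := fun n => by
    simpa using pow_apply_eq_smul (z := 1) (hρ.trans (one_smul ℂ ρ).symm) n
  set σ : H →L[ℂ] H := (Module.finrank ℂ H : ℂ)⁻¹ • 1
  have hσ : IsState σ := isState_maximallyMixed
  have hσρ : σ - ρ ∈ LinearMap.ker (operatorTrace H) := by
    rw [LinearMap.mem_ker, map_sub, htrace, sub_eq_zero]
    exact hσ.2
  have hlim : Tendsto (fun n => (Φ ^ n) σ) atTop (𝓝 ρ) := by
    simpa only [map_sub, hpow, tendsto_sub_nhds_zero_iff] using hstable _ hσρ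
  have hρstate : IsState ρ := ⟨isClosed_isPositive.mem_of_tendsto hlim
    (.of_forall fun n => (hσ.apply (pow_mem hΦ n)).1), htrace⟩
  refine ⟨ρ, ⟨hρstate, hρ⟩, fun τ hτ => sub_eq_zero.1 ?_⟩
  exact hstable.eq_zero_of_fixed (hτ.1.sub_mem_ker_operatorTrace hρstate)
    (by rw [map_sub, hτ.2, hρ])

end Ergodicity

section StateAverages

variable {H : Type*} [NormedAddCommGroup H] [InnerProductSpace ℂ H]

theorem stateAt_eq_randomProduct {Ω : Type*} (L : Ω → (H →L[ℂ] H) →L[ℂ] (H →L[ℂ] H))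
    (ω : ℕ+ → Ω) (ρ : H →L[ℂ] H) (n : ℕ) : stateAt L ω ρ n = randomProduct L ω n ρ := by
  induction n with
  | zero => rfl
  | succ n ih => rw [stateAt, randomProduct, mul_apply_eq_comp, ih]

variable [FiniteDimensional ℂ H]

theorem ae_tendsto_average_stateAt {Ω : Type*} [MeasurableSpace Ω] {p : Measure Ω}
    [IsProbabilityMeasure p] {L : Ω → (H →L[ℂ] H) →L[ℂ] (H →L[ℂ] H)} (hLm : Measurable L)
    (hL : ∀ x, L x ∈ positiveTracePreserving H)
    (hstable : IsStableOn (∫ x, L x ∂p) (LinearMap.ker (operatorTrace H)))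
    {σ : H →L[ℂ] H} (hσ : IsState σ) (hfix : (∫ x, L x ∂p) σ = σ) :
    ∀ᵐ ω ∂Measure.infinitePi fun _ : ℕ+ => p, ∀ ρ : H →L[ℂ] H, IsState ρ →
      Tendsto (fun N : ℕ => (N : ℂ)⁻¹ • ∑ n ∈ Finset.Icc 1 N, stateAt L ω ρ n) atTop (𝓝 σ) := by
  have hbdd := isBounded_positiveTracePreserving (H := H)
  filter_upwards [ae_tendsto_average_increments_randomProduct hLm hbdd hL] with ω hω ρ hρ
  have hstate : ∀ n, IsState (stateAt L ω ρ n) := fun n => by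
    rw [stateAt_eq_randomProduct]
    exact hρ.apply (randomProduct_mem hL ω n)
  refine tendsto_average_Icc_of_tendsto_average_sub
    (tendsto_average_of_tendsto_average_increments (r := fun n => stateAt L ω ρ n - σ)
      (F := ∫ x, L x ∂p) (fun x => hstable.eq_zero_of_fixed) ?_
      (fun n => (hstate n).sub_mem_ker_operatorTrace hσ) ?_)
  · obtain ⟨C, hC⟩ := isBounded_iff_forall_norm_le.1 hbdd
    refine isBounded_iff_forall_norm_le.2 ⟨C * ‖ρ‖ + ‖σ‖, Set.forall_mem_range.2 fun n => ?_⟩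
    rw [stateAt_eq_randomProduct]
    exact norm_sub_le_of_le (ContinuousLinearMap.le_of_opNorm_le _
      (hC _ (randomProduct_mem hL ω n)) ρ) le_rfl
  · have hω' := ((ContinuousLinearMap.apply ℂ (H →L[ℂ] H) ρ).continuous.tendsto 0).comp hω
    rw [map_zero] at hω'
    refine hω'.congr fun N => ?_
    rw [Function.comp_apply, ← Complex.coe_smul, Complex.ofReal_inv, Complex.ofReal_natCast,
      map_smul, map_sum]
    refine congrArg _ (Finset.sum_congr rfl fun n _ => ?_)
    rw [map_sub, map_sub, hfix, sub_sub_sub_cancel_right, stateAt_eq_randomProduct,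
      stateAt_eq_randomProduct]
    rfl

end StateAverages

end RepeatedInteraction

open RepeatedInteraction in
theorem mainTheorem2_general
    {H : Type*} [NormedAddCommGroup H] [InnerProductSpace ℂ H] [FiniteDimensional ℂ H]
    {Ω₀ : Type*} [MeasurableSpace Ω₀] (p : Measure Ω₀) [IsProbabilityMeasure p]
    (L : Ω₀ → (H →L[ℂ] H) →L[ℂ] (H →L[ℂ] H)) (hL_meas : Measurable L)
    (hL : ∀ ω₀, L ω₀ ∈ positiveTracePreserving H) (hpos : 0 < p {ω₀ | IsErgodic (L ω₀)}) :
    Integrable L p ∧ IsErgodic (∫ ω₀, L ω₀ ∂p) ∧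
    ∃ ρplus : H →L[ℂ] H, (IsState ρplus ∧ (∫ ω₀, L ω₀ ∂p) ρplus = ρplus) ∧
      (∀ σ : H →L[ℂ] H, IsState σ → (∫ ω₀, L ω₀ ∂p) σ = σ → σ = ρplus) ∧
      ∃ Ωt : Set (ℕ+ → Ω₀), MeasurableSet Ωt ∧ Measure.infinitePi (fun _ : ℕ+ => p) Ωt = 1 ∧
        ∀ ω ∈ Ωt, ∀ ρ : H →L[ℂ] H, IsState ρ →
          Tendsto (fun N : ℕ => (N : ℂ)⁻¹ • ∑ n ∈ Finset.Icc 1 N, stateAt L ω ρ n)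
            atTop (𝓝 ρplus) := by
  obtain ⟨ω₀, hω₀⟩ := nonempty_of_measure_ne_zero hpos.ne'
  have : Nontrivial H := IsErgodic.nontrivial hω₀
  have hbdd := isBounded_positiveTracePreserving (H := H)
  have hint : Integrable L p := integrable_of_isBounded hbdd hL_meas hL
  have hmean : (∫ ω₀, L ω₀ ∂p) ∈ positiveTracePreserving H :=
    ((convex_positiveTracePreserving (H := H)).integral_mem isClosed_positiveTracePreserving
      (ae_of_all p hL) hint :)
  have hstable_pos : 0 < p {ω₀ | IsStableOn (L ω₀) (LinearMap.ker (operatorTrace H))} :=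
    hpos.trans_le (measure_mono fun ω₀ => (isErgodic_iff_isStableOn (hL ω₀)).1)
  have hstable : IsStableOn (∫ ω₀, L ω₀ ∂p) (LinearMap.ker (operatorTrace H)) :=
    isStableOn_integral hbdd convex_positiveTracePreserving isClosed_positiveTracePreserving
      (fun Φ hΦ x hx => (hΦ.2 x).trans hx) hL_meas hL hstable_pos.ne'
  obtain ⟨ρplus, hρplus, hunique⟩ := hstable.existsUnique_isState_fixed hmean
  obtain ⟨Ωt, hΩt, hΩt_meas, hlim⟩ :=
    (ae_tendsto_average_stateAt hL_meas hL hstable hρplus.1 hρplus.2).exists_measurable_mem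
  exact ⟨hint, (isErgodic_iff_isStableOn hmean).2 hstable, ρplus, hρplus,
    fun σ hσ hfix => hunique σ ⟨hσ, hfix⟩, Ωt, hΩt_meas, mem_ae_iff_prob_eq_one hΩt_meas |>.1 hΩt,
    hlim⟩

theorem mainTheorem2
    {H : Type u} [NormedAddCommGroup H] [InnerProductSpace ℂ H] [FiniteDimensional ℂ H]
    (hS : H →ₗ[ℂ] H) (hhS : hS.IsSymmetric)
    {Ω₀ : Type*} [MeasurableSpace Ω₀] (p : Measure Ω₀) [IsProbabilityMeasure p]
    (L : Ω₀ → (H →L[ℂ] H) →L[ℂ] (H →L[ℂ] H)) (hL_meas : Measurable L)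
    (hL : ∀ ω₀, RepeatedInteraction.IsReducedDynamicsMap.{u, v} hS (L ω₀))
    (hpos : 0 < p {ω₀ | L ω₀ ∈ RepeatedInteraction.ergodicMaps.{u, v} hS}) :
    Integrable L p ∧
    RepeatedInteraction.IsErgodic (∫ ω₀, L ω₀ ∂p) ∧
    ∃ ρplus : H →L[ℂ] H,
      (RepeatedInteraction.IsState ρplus ∧ (∫ ω₀, L ω₀ ∂p) ρplus = ρplus) ∧
      (∀ σ : H →L[ℂ] H, RepeatedInteraction.IsState σ → (∫ ω₀, L ω₀ ∂p) σ = σ → σ = ρplus) ∧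
      ∃ Ωt : Set (ℕ+ → Ω₀), MeasurableSet Ωt ∧
        Measure.infinitePi (fun _ : ℕ+ => p) Ωt = 1 ∧
        ∀ ω ∈ Ωt, ∀ ρ : H →L[ℂ] H, RepeatedInteraction.IsState ρ →
          Tendsto (fun N : ℕ => (N : ℂ)⁻¹ •
              ∑ n ∈ Finset.Icc 1 N, RepeatedInteraction.stateAt L ω ρ n)
            atTop (𝓝 ρplus) := by
  exact mainTheorem2_general p L hL_meas (fun ω₀ => (hL ω₀).mem_positiveTracePreserving)
    (hpos.trans_le (measure_mono fun _ hω₀ => hω₀.2))
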